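/- Let $n\ge 0$, $d=2^n$. A linear XEB scheme $(S,\mu,\phi,M,\rho_0)$ on $n$ qubits consists of a set $S\subseteq SU(d)$, a probability measure $\mu$ on $SU(d)$ carried by $S$, a (measurable) map $\phi$ from $S$ to the quantum channels on $n$ qubits, a POVM $M=\{M_x\}_{x\in\{0,1\}^n}$ and a density matrix $\rho_0$. Its linear XEB value after $m\ge 0$ cycles is $$q_R(m)=-1+2^n\,\mathbb E_{g_1,\dots,g_m\sim\mu}\Big[\sum_{x\in\{0,1\}^n}|\langle x|g_m\cdots g_1|0^n\rangle|^2\,\mathrm{tr}\big[M_x\,(\phi(g_m)\circ\cdots\circ\phi(g_1))(\rho_0)\big]\Big],$$ where $g_1,\dots,g_m$ are independent. For $g\in SU(d)$ let $\omega(g):X\mapsto gXg^\dagger$. The twirling map of a probability measure $\mu$ on $SU(d)$ is the linear operator $\Lambda(\mu):\mathcal C\mapsto\int \omega(g^\dagger)\circ\mathcal C\circ\omega(g)\,d\mu(g)$ on superoperators; it is a $\gamma$-approximate twirl in spectral norm if $|||\Lambda(\mu)-\Lambda(\mu_H)|||_2\le\gamma$, where $\mu_H$ is the Haar probability measure on $SU(d)$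 and $|||\cdot|||_2$ is the operator norm with respect to the Hilbert--Schmidt norm on superoperators. Let $\|\cdot\|_\diamond$ be the diamond norm. Theorem. Let $(S,\mu,\phi,M,\rho_0)$ be a linear XEB scheme on $n$ qubits. Suppose that the twirling map of $\mu$ is a $\gamma$-approximate twirl in spectral norm, and that every $\phi(g)$, $g\in S$, is a probabilistic mixture of unitary channels, $\phi(g)=\int \omega(u)\,d\nu_g(u)$, for a probability measure $\nu_g$ on $SU(d)$ (such that $g\mapsto\mathbb E_{u\sim\nu_g}\|\omega(g)-\omega(u)\|_\diamond$ is $\mu$-integrable). Suppose further that $$\mathbb E_{g\sim\mu}\,\mathbb E_{u\sim\nu_g}\,\|\omega(g)-\omega(u)\|_\diamond\le\delta\le\frac{1-\gamma}{11}.$$ Then there exist $A,B\in\mathbb R$ and $p\in[1-2\delta,1]$ such that for all $m\ge 0$ $$|q_R(m)-(A+Bp^m)|\le 16\cdot 2^{\frac52 n}(\gamma+6\delta)^m.$$ -/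

import Mathlib

open MeasureTheory Matrix
open scoped ComplexOrder

noncomputable section

namespace XEB

/-- Bit strings of length `n`; they label the computational basis of `n` qubits. -/
abbrev Bits (n : ℕ) : Type := Fin n → Bool

/-- The bit string `0ⁿ`. -/
def zeroBits (n : ℕ) : Bits n := fun _ => false

/-- Operators on the `2 ^ n`-dimensional space of `n` qubits. -/
abbrev Op (n : ℕ) : Type := Matrix (Bits n) (Bits n) ℂ

/-- Superoperators on `n` qubits. -/
abbrev Superop (n : ℕ) : Type := Op n →ₗ[ℂ] Op n

/-- The special unitary group `SU(2 ^ n)`. -/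
abbrev SU (n : ℕ) : Type := Matrix.specialUnitaryGroup (Bits n) ℂ

/-! ### `SU(2 ^ n)` as a compact topological group with its Borel sets -/

instance (n : ℕ) : MeasurableSpace (SU n) := borel (SU n)

instance (n : ℕ) : BorelSpace (SU n) := ⟨rfl⟩

lemma SU.coe_inv {n : ℕ} (g : SU n) : ((g⁻¹ : SU n) : Op n) = (g : Op n)ᴴ := rfl

instance (n : ℕ) : IsTopologicalGroup (SU n) where
  continuous_inv := by
    refine Continuous.subtype_mk (f := fun g : SU n => (g : Op n)ᴴ) ?_ _
    exact continuous_subtype_val.matrix_conjTranspose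

instance (n : ℕ) : CompactSpace (SU n) := by
  suffices h : IsCompact (Matrix.specialUnitaryGroup (Bits n) ℂ : Set (Op n)) from
    isCompact_iff_compactSpace.mp h
  have hK : IsCompact (Set.pi Set.univ fun _ : Bits n =>
      Set.pi Set.univ fun _ : Bits n => Metric.closedBall (0 : ℂ) 1) :=
    isCompact_univ_pi fun _ => isCompact_univ_pi fun _ => isCompact_closedBall _ _
  refine IsCompact.of_isClosed_subset hK ?_ ?_
  · have h1 : (Matrix.specialUnitaryGroup (Bits n) ℂ : Set (Op n))
        = {A : Op n | A * Aᴴ = 1} ∩ {A : Op n | A.det = 1} := by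
      ext A
      simp only [SetLike.mem_coe, Matrix.mem_specialUnitaryGroup_iff,
        Matrix.mem_unitaryGroup_iff, Set.mem_inter_iff, Set.mem_ofPred_eq,
        Matrix.star_eq_conjTranspose]
    rw [h1]
    refine IsClosed.inter (isClosed_eq ?_ continuous_const) (isClosed_eq ?_ continuous_const)
    · exact continuous_id.matrix_mul continuous_id.matrix_conjTranspose
    · exact continuous_id.matrix_det
  · intro A hA i _ j _
    rw [mem_closedBall_zero_iff]
    exact entry_norm_bound_of_unitary (Matrix.mem_specialUnitaryGroup_iff.mp hA).1 i j

/-- The normalized Haar measure on `SU(2 ^ n)`. -/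
def haarSU (n : ℕ) : Measure (SU n) := Measure.haarMeasure ⊤

instance (n : ℕ) : IsProbabilityMeasure (haarSU n) :=
  ⟨by
    have h := Measure.haarMeasure_self (K₀ := (⊤ : TopologicalSpace.PositiveCompacts (SU n)))
    simpa [haarSU] using h⟩

/-! ### Unitary channels and the twirling map -/

/-- The unitary channel `ω(g) : X ↦ g X g†`. -/
def omega {n : ℕ} (g : SU n) : Superop n where
  toFun X := (g : Op n) * X * (g : Op n)ᴴ
  map_add' X Y := by rw [mul_add, add_mul]
  map_smul' c X := by simp

/-- The integrand `ω(g†) ∘ C ∘ ω(g)` of the twirling map. -/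
def twirlIntegrand {n : ℕ} (C : Superop n) (g : SU n) : Superop n :=
  omega g⁻¹ ∘ₗ C ∘ₗ omega g

lemma integrable_twirlIntegrand {n : ℕ} (μ : Measure (SU n)) [IsFiniteMeasure μ]
    (C : Superop n) (X : Op n) (i j : Bits n) :
    Integrable (fun g => twirlIntegrand C g X i j) μ := by
  have hval : Continuous fun g : SU n => (g : Op n) := continuous_subtype_val
  have hC : Continuous C := LinearMap.continuous_of_finiteDimensional C
  have hin : Continuous fun g : SU n => C ((g : Op n) * X * (g : Op n)ᴴ) :=
    hC.comp ((hval.matrix_mul continuous_const).matrix_mul hval.matrix_conjTranspose)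
  have hcont : Continuous fun g : SU n =>
      ((g : Op n)ᴴ * C ((g : Op n) * X * (g : Op n)ᴴ) * ((g : Op n)ᴴ)ᴴ) i j :=
    ((hval.matrix_conjTranspose.matrix_mul hin).matrix_mul
      hval.matrix_conjTranspose.matrix_conjTranspose).matrix_elem i j
  exact hcont.integrable_of_hasCompactSupport (HasCompactSupport.of_compactSpace _)

/-- The twirling map `Λ(μ) : C ↦ ∫ ω(g†) ∘ C ∘ ω(g) dμ(g)`, the integral being taken entrywise. -/
def twirl {n : ℕ} (μ : Measure (SU n)) [IsFiniteMeasure μ] : Superop n →ₗ[ℂ] Superop n where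
  toFun C :=
    { toFun := fun X => Matrix.of fun i j => ∫ g, twirlIntegrand C g X i j ∂μ
      map_add' := fun X Y => by
        ext i j
        simp only [Matrix.of_apply, Matrix.add_apply, map_add]
        exact integral_add (integrable_twirlIntegrand μ C X i j)
          (integrable_twirlIntegrand μ C Y i j)
      map_smul' := fun c X => by
        ext i j
        simp only [Matrix.of_apply, Matrix.smul_apply, map_smul, RingHom.id_apply]
        exact integral_smul c _ }
  map_add' C C' := by
    ext X i j : 3
    have h : ∀ g, twirlIntegrand (C + C') g X i j
        = twirlIntegrand C g X i j + twirlIntegrand C' g X i j := fun g => by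
      simp [twirlIntegrand]
    simp only [LinearMap.add_apply, LinearMap.coe_mk, AddHom.coe_mk, Matrix.of_apply,
      Matrix.add_apply, h]
    exact integral_add (integrable_twirlIntegrand μ C X i j)
      (integrable_twirlIntegrand μ C' X i j)
  map_smul' c C := by
    ext X i j : 3
    have h : ∀ g, twirlIntegrand (c • C) g X i j = c • twirlIntegrand C g X i j := fun g => by
      simp [twirlIntegrand]
    simp only [LinearMap.smul_apply, LinearMap.coe_mk, AddHom.coe_mk, Matrix.of_apply,
      Matrix.smul_apply, h, RingHom.id_apply]
    exact integral_smul c _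

/-! ### Norms -/

/-- The Hilbert-Schmidt norm of a superoperator, computed on the orthonormal basis of matrix
units. -/
def hsNorm {n : ℕ} (C : Superop n) : ℝ :=
  Real.sqrt (∑ i, ∑ j, ∑ k, ∑ l, ‖C (Matrix.single i j 1) k l‖ ^ 2)

/-- The spectral norm `|||Λ|||₂` of a linear operator on superoperators: its operator norm with
respect to the Hilbert-Schmidt norm, that is, its largest singular value. -/
def spectralNorm {n : ℕ} (Λ : Superop n →ₗ[ℂ] Superop n) : ℝ :=
  sSup {r : ℝ | ∃ C : Superop n, hsNorm C ≤ 1 ∧ r = hsNorm (Λ C)}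

/-- The twirling map of `μ` is a `γ`-approximate twirl in spectral norm. -/
def IsApproxTwirlSpectral {n : ℕ} (μ : Measure (SU n)) [IsFiniteMeasure μ] (γ : ℝ) : Prop :=
  spectralNorm (twirl μ - twirl (haarSU n)) ≤ γ

/-- The trace norm of a square matrix: the sum of its singular values. -/
def traceNorm {ι : Type} [Fintype ι] [DecidableEq ι] (X : Matrix ι ι ℂ) : ℝ :=
  ∑ i, Real.sqrt ((isHermitian_conjTranspose_mul_self X).eigenvalues i)

/-- The map `id ⊗ Φ` on operators of a composite system with ancilla basis `κ`. -/
def amplify {n : ℕ} (κ : Type) (Φ : Superop n) (X : Matrix (κ × Bits n) (κ × Bits n) ℂ) :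
    Matrix (κ × Bits n) (κ × Bits n) ℂ :=
  Matrix.of fun p q => Φ (Matrix.of fun i j => X (p.1, i) (q.1, j)) p.2 q.2

/-- The diamond norm `‖Φ‖_⋄`: the trace norm to trace norm operator norm of `id ⊗ Φ`, with an
ancilla of the same dimension as the system. -/
def diamondNorm {n : ℕ} (Φ : Superop n) : ℝ :=
  sSup {r : ℝ | ∃ X : Matrix (Bits n × Bits n) (Bits n × Bits n) ℂ,
    traceNorm X ≤ 1 ∧ r = traceNorm (amplify (Bits n) Φ X)}

/-! ### Channels, states, measurements -/

/-- Quantum channels: completely positive and trace-preserving maps. -/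
structure IsChannel {n : ℕ} (Φ : Superop n) : Prop where
  completelyPositive : ∀ (k : ℕ) (X : Matrix (Fin k × Bits n) (Fin k × Bits n) ℂ),
    X.PosSemidef → (amplify (Fin k) Φ X).PosSemidef
  tracePreserving : ∀ X : Op n, (Φ X).trace = X.trace

/-- Density matrices. -/
structure IsState {n : ℕ} (ρ : Op n) : Prop where
  posSemidef : ρ.PosSemidef
  trace_eq_one : ρ.trace = 1

/-- Positive operator-valued measures with outcomes in `{0,1}ⁿ`. -/
structure IsPOVM {n : ℕ} (M : Bits n → Op n) : Prop where
  posSemidef : ∀ x, (M x).PosSemidef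
  sum_eq_one : ∑ x, M x = 1

/-- The superoperator `Φ` is the probabilistic mixture `∫ u dν(u)` of the unitary channels
`u = ω(U)`, `U ∼ ν`. -/
structure IsUnitaryMixture {n : ℕ} (Φ : Superop n) (ν : Measure (SU n)) : Prop where
  isProbabilityMeasure : IsProbabilityMeasure ν
  eq_integral : ∀ (X : Op n) (i j : Bits n), Φ X i j = ∫ u, omega u X i j ∂ν

/-! ### Linear cross-entropy benchmarking -/

/-- A linear XEB scheme `(S, μ, φ, M, ρ₀)` on `n` qubits. The values of `φ` outside `S` play no
role. -/
structure LinearXEB (n : ℕ) where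
  /-- the gate set -/
  S : Set (SU n)
  /-- the distribution of the gates -/
  μ : Measure (SU n)
  /-- the noisy implementation of the gates -/
  φ : SU n → Superop n
  /-- the final measurement -/
  M : Bits n → Op n
  /-- the initial state -/
  ρ₀ : Op n
  isProbabilityMeasure : IsProbabilityMeasure μ
  ae_mem : ∀ᵐ g ∂μ, g ∈ S
  isChannel : ∀ g ∈ S, IsChannel (φ g)
  aemeasurable : ∀ (X : Op n) (i j : Bits n), AEMeasurable (fun g => φ g X i j) μ
  isPOVM : IsPOVM M
  isState : IsState ρ₀

attribute [instance] LinearXEB.isProbabilityMeasure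

/-- The ideal circuit `g_m ⋯ g_2 g_1`. -/
def idealCircuit {n : ℕ} : (m : ℕ) → (Fin m → SU n) → SU n
  | 0, _ => 1
  | m + 1, g => g (Fin.last m) * idealCircuit m fun i => g i.castSucc

/-- The noisy circuit `φ(g_m) ∘ ⋯ ∘ φ(g_2) ∘ φ(g_1)`. -/
def noisyCircuit {n : ℕ} (φ : SU n → Superop n) : (m : ℕ) → (Fin m → SU n) → Superop n
  | 0, _ => LinearMap.id
  | m + 1, g => φ (g (Fin.last m)) ∘ₗ noisyCircuit φ m fun i => g i.castSucc

namespace LinearXEB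

variable {n : ℕ} (E : LinearXEB n)

/-- The ideal probability `|⟨x| g_m ⋯ g_1 |0ⁿ⟩|²`. -/
def idealProb {m : ℕ} (g : Fin m → SU n) (x : Bits n) : ℝ :=
  ‖(idealCircuit m g : Op n) x (zeroBits n)‖ ^ 2

/-- The probability `tr[M_x φ(g_m) ∘ ⋯ ∘ φ(g_1) (ρ₀)]` of measuring `x` in the noisy circuit. -/
def noisyProb {m : ℕ} (g : Fin m → SU n) (x : Bits n) : ℝ :=
  (E.M x * noisyCircuit E.φ m g E.ρ₀).trace.re

/-- The linear XEB value `q_R(m)` for `m` cycles of independent gates distributed as `μ`. -/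
def qR (m : ℕ) : ℝ :=
  -1 + 2 ^ n * ∫ g : Fin m → SU n, ∑ x, idealProb g x * E.noisyProb g x ∂Measure.pi fun _ => E.μ

end LinearXEB

end XEB

end

noncomputable section

namespace XEB

/-! ### Perturbation of an isolated eigenvalue -/

/-! Place the final measurement, viewed as a superoperator, between the noisy circuit and the
inverse ideal circuit. By independence of the gates, `E.qR m` is read off linearly from the `m`-th
power of one operator on superoperators, `T : C ↦ 𝔼 ω(g⁻¹) ∘ C ∘ φ(g)` (`integral_amplitude`,
`LinearXEB.qR_eq`). `T` fixes the depolarizing channel, whose contribution cancels the `-1`; what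
remains lies in the real space of Hermiticity-preserving maps with traceless values, which `T`
preserves.

On this space `T` is compared with its noiseless version `S`, the twirl of `μ`. `S` fixes `centering
n` and preserves the trace of a superoperator, hence the inner product with `centering n`. On the
orthogonal complement the Haar twirl vanishes because the traceless matrices are irreducible
(`IsCovariant.eq_zero`), so `S` has norm at most `γ` there. Mixtures of unitary channels make `T` a
contraction, and `‖T - S‖ ≤ δ` since for differences of unitary channels the Hilbert-Schmidt
operator norm is at most the diamond norm (`hsNorm_comp_omega_sub_le`).

`exists_dominant_eigenvalue` then perturbs the eigenvalue `1` of `S` to a real eigenvalue `p` of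
`T`; the rest of `T ^ m` is `O((γ + 6δ)^m)`. The prefactor comes from the factor `2 ^ n` in the XEB
value and the Hilbert-Schmidt norms of state and measurement. -/

lemma mem_resolventSet_of_lt {H : Type*} [NormedAddCommGroup H] [NormedSpace ℝ H]
    [CompleteSpace H] (K : H →L[ℝ] H) {p : ℝ} (hp : ‖K‖ < p) : p ∈ resolventSet ℝ K := by
  refine spectrum.mem_resolventSet_of_norm_lt_mul ?_
  have h1 : ‖(1 : H →L[ℝ] H)‖ ≤ 1 := ContinuousLinearMap.norm_id_le
  have h0 := norm_nonneg K
  rw [Real.norm_of_nonneg (h0.trans hp.le)]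
  nlinarith

lemma smul_resolvent_sub {H : Type*} [NormedAddCommGroup H] [NormedSpace ℝ H]
    [CompleteSpace H] (K : H →L[ℝ] H) {p : ℝ} (hp : ‖K‖ < p) (x : H) :
    p • resolvent K p x - K (resolvent K p x) = x := by
  have h := Ring.mul_inverse_cancel _ (mem_resolventSet_of_lt K hp)
  have := congrArg (fun A : H →L[ℝ] H => A x) h
  simpa [resolvent, Algebra.algebraMap_eq_smul_one] using this

lemma resolvent_smul_sub {H : Type*} [NormedAddCommGroup H] [NormedSpace ℝ H]
    [CompleteSpace H] (K : H →L[ℝ] H) {p : ℝ} (hp : ‖K‖ < p) (x : H) :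
    p • resolvent K p x - resolvent K p (K x) = x := by
  have h := Ring.inverse_mul_cancel _ (mem_resolventSet_of_lt K hp)
  have := congrArg (fun A : H →L[ℝ] H => A x) h
  simpa [resolvent, Algebra.algebraMap_eq_smul_one] using this

lemma norm_resolvent_apply_le {H : Type*} [NormedAddCommGroup H] [NormedSpace ℝ H]
    [CompleteSpace H] (K : H →L[ℝ] H) {p : ℝ} (hp : ‖K‖ < p) (x : H) :
    (p - ‖K‖) * ‖resolvent K p x‖ ≤ ‖x‖ := by
  have h := smul_resolvent_sub K hp x
  have h1 : ‖p • resolvent K p x‖ ≤ ‖x‖ + ‖K (resolvent K p x)‖ := by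
    conv_lhs => rw [eq_add_of_sub_eq h]
    exact norm_add_le _ _
  rw [norm_smul, Real.norm_of_nonneg ((norm_nonneg K).trans hp.le)] at h1
  have h2 := K.le_opNorm (resolvent K p x)
  linarith

lemma continuousOn_resolvent {H : Type*} [NormedAddCommGroup H] [NormedSpace ℝ H]
    [CompleteSpace H] (K : H →L[ℝ] H) : ContinuousOn (resolvent K) (Set.Ioi ‖K‖) := by
  intro p hp
  obtain ⟨u, hu⟩ := mem_resolventSet_of_lt K hp
  have h1 : ContinuousAt Ring.inverse (algebraMap ℝ (H →L[ℝ] H) p - K) := by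
    rw [← hu]; exact NormedRing.inverse_continuousAt u
  have h2 : ContinuousAt (fun q : ℝ => algebraMap ℝ (H →L[ℝ] H) q - K) p := by fun_prop
  exact (ContinuousAt.comp (f := fun q : ℝ => algebraMap ℝ (H →L[ℝ] H) q - K)
    h1 h2).continuousWithinAt

/-- If `T` is a contraction close to an operator `S` that fixes the unit vector `v` and contracts
its orthogonal complement, the powers of `T` are, up to an exponentially small error, those of
a single real eigenvalue close to `1`. -/
theorem exists_dominant_eigenvalue {H : Type*} [NormedAddCommGroup H] [InnerProductSpace ℝ H]
    [CompleteSpace H] (T S : H →L[ℝ] H) (v : H) (hv : ‖v‖ = 1) (γ δ : ℝ) (hγ : 0 ≤ γ)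
    (hγ1 : γ < 1) (hδ : 0 ≤ δ) (hδγ : 11 * δ ≤ 1 - γ) (hSv : S v = v)
    (hvS : ∀ w, inner ℝ v (S w) = inner ℝ v w)
    (hS : ∀ w, inner ℝ v w = 0 → ‖S w‖ ≤ γ * ‖w‖) (hT : ∀ w, ‖T w‖ ≤ ‖w‖)
    (hTS : ∀ w, ‖T w - S w‖ ≤ δ * ‖w‖) :
    ∃ p ∈ Set.Icc (1 - 2 * δ) 1, ∃ Q : H → H, ∀ (m : ℕ) (z : H),
      ‖(T ^ m) z - p ^ m • Q z‖ ≤ 3 * (γ + 6 * δ) ^ m * ‖z‖ := by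
  have hvv : inner ℝ v v = (1 : ℝ) := by rw [real_inner_self_eq_norm_sq, hv]; norm_num
  -- the projection onto the orthogonal complement of `v`
  let Q : H →L[ℝ] H := ContinuousLinearMap.id ℝ H - (innerSL ℝ v).smulRight v
  have hQ : ∀ x, Q x = x - inner ℝ v x • v := fun x => by simp [Q]
  have hvQ : ∀ x, inner ℝ v (Q x) = (0 : ℝ) := fun x => by
    rw [hQ, inner_sub_right, inner_smul_right, hvv]; ring
  have hQn : ∀ x, ‖Q x‖ ≤ ‖x‖ := fun x => by
    have h : ‖x‖ * ‖x‖ = ‖inner ℝ v x • v‖ * ‖inner ℝ v x • v‖ + ‖Q x‖ * ‖Q x‖ := by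
      rw [← norm_add_sq_eq_norm_sq_add_norm_sq_real (x := inner ℝ v x • v) (y := Q x)]
      · rw [hQ]; simp
      · rw [inner_smul_left, hvQ, mul_zero]
    nlinarith [norm_nonneg x, norm_nonneg (Q x), mul_self_nonneg ‖inner ℝ v x • v‖]
  have hQv : Q v = 0 := by rw [hQ, hvv]; simp
  have hQQ : ∀ x, Q (Q x) = Q x := fun x => by rw [hQ (Q x), hvQ]; simp
  have hiv : ∀ x, |inner ℝ v x| ≤ ‖x‖ := fun x => by
    simpa [hv] using abs_real_inner_le_norm v x
  -- In the splitting `ℝ v ⊕ v^⊥`, `T` has the blocks `a`, `b`, `c`, `K`. Eliminating the component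
  -- in `v^⊥` turns the eigenvalue equation into the scalar equation `p = a + b (p - K)⁻¹ c`.
  let K : H →L[ℝ] H := Q ∘L T ∘L Q
  have hK : ∀ x, K x = Q (T (Q x)) := fun x => rfl
  have hTQ : ∀ x, ‖T (Q x)‖ ≤ (γ + δ) * ‖x‖ := fun x => by
    have h1 := hS (Q x) (hvQ x)
    have h2 := hTS (Q x)
    have h3 : ‖T (Q x)‖ ≤ ‖T (Q x) - S (Q x)‖ + ‖S (Q x)‖ := by
      simpa using norm_add_le (T (Q x) - S (Q x)) (S (Q x))
    nlinarith [hQn x]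
  have hKn : ‖K‖ ≤ γ + δ := ContinuousLinearMap.opNorm_le_bound _ (by positivity) fun x =>
    (hQn _).trans (hTQ x)
  let c : H := Q (T v)
  have hc : ‖c‖ ≤ δ := by
    have h : c = Q (T v - S v) := by rw [map_sub, hSv, hQv, sub_zero]
    rw [h]
    simpa [hv] using (hQn _).trans (hTS v)
  let a : ℝ := inner ℝ v (T v)
  have ha : |a - 1| ≤ δ := by
    have h : a - 1 = inner ℝ v (T v - S v) := by rw [inner_sub_right, hvS, hvv]
    rw [h]
    simpa [hv] using (hiv _).trans (hTS v)
  let b : H →L[ℝ] ℝ := (innerSL ℝ v) ∘L T ∘L Q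
  have hb' : ∀ x, b x = inner ℝ v (T (Q x)) := fun x => by simp [b]
  have hb : ∀ x, |b x| ≤ δ * ‖x‖ := fun x => by
    have h : b x = inner ℝ v (T (Q x) - S (Q x)) := by
      rw [inner_sub_right, hvS, hvQ, sub_zero, hb']
    rw [h]
    exact ((hiv _).trans (hTS _)).trans (by gcongr; exact hQn x)
  -- A lower bound for `p - ‖K‖` when `p ≥ 1 - 2δ`, as `‖K‖ ≤ γ + δ`. The constant 11 in the
  -- hypothesis yields `η ≥ 8δ`.
  let η : ℝ := 1 - γ - 3 * δ
  have hη : 0 < η := by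
    rcases hδ.eq_or_lt with h | h
    · simp only [η]; rw [← h]; linarith
    · simp only [η]; linarith
  have hδη : 8 * δ ≤ η := by simp only [η]; linarith
  have hR : ∀ p, 1 - 2 * δ ≤ p → ∀ x, η * ‖resolvent K p x‖ ≤ ‖x‖ := fun p hp x => by
    refine le_trans ?_ (norm_resolvent_apply_le K (p := p) (by simp only [η] at hη; linarith) x)
    gcongr
    simp only [η]; linarith
  have hδR : ∀ p, 1 - 2 * δ ≤ p → ∀ x, 8 * (δ * ‖resolvent K p x‖) ≤ ‖x‖ := fun p hp x => by
    refine le_trans ?_ (hR p hp x)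
    rw [← mul_assoc]
    gcongr
  have hbR : ∀ p, 1 - 2 * δ ≤ p → ∀ x, 8 * |b (resolvent K p x)| ≤ ‖x‖ := fun p hp x => by
    have := hb (resolvent K p x)
    have := hδR p hp x
    linarith
  -- the eigenvalue
  obtain ⟨p, hp, hpe⟩ : ∃ p ∈ Set.Icc (1 - 2 * δ) (1 + 2 * δ), p - a - b (resolvent K p c) = 0 := by
    have hcont : ContinuousOn (fun p => p - a - b (resolvent K p c))
        (Set.Icc (1 - 2 * δ) (1 + 2 * δ)) := by
      refine ContinuousOn.sub (by fun_prop) (b.continuous.comp_continuousOn ?_)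
      refine ContinuousOn.clm_apply ((continuousOn_resolvent K).mono ?_) continuousOn_const
      intro q hq
      have := hq.1
      simp only [Set.mem_Ioi]
      simp only [η] at hη; linarith
    have h := intermediate_value_Icc (by linarith) hcont
    -- `a` is within `δ` of `1` and the resolvent term is at most `δ / 8`, so the function changes
    -- sign between `1 - 2δ` and `1 + 2δ`.
    have h0 : (0 : ℝ) ∈ Set.Icc (1 - 2 * δ - a - b (resolvent K (1 - 2 * δ) c))
        (1 + 2 * δ - a - b (resolvent K (1 + 2 * δ) c)) := by
      have h1 := hbR (1 - 2 * δ) le_rfl c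
      have h2 := hbR (1 + 2 * δ) (by linarith) c
      have h3 := abs_le.mp ha
      have h4 := neg_abs_le (b (resolvent K (1 - 2 * δ) c))
      have h5 := le_abs_self (b (resolvent K (1 + 2 * δ) c))
      constructor <;> linarith
    obtain ⟨p, hp, hpe⟩ := h h0
    exact ⟨p, hp, hpe⟩
  have hKp : ‖K‖ < p := by
    have := hp.1
    simp only [η] at hη; linarith
  let R : H →L[ℝ] H := resolvent K p
  let y : H →L[ℝ] ℝ := b ∘L R
  have hy : ∀ x, 8 * |y x| ≤ ‖x‖ := fun x => hbR p hp.1 x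
  have hyK : ∀ x, p * y x - y (K x) = b x := fun x => by
    have := congrArg b (resolvent_smul_sub K hKp x)
    simpa [y, R] using this
  have hp0 : 0 < p := (norm_nonneg K).trans_lt hKp
  have hyv : y v = 0 := by
    have h := hyK v
    have h1 : K v = 0 := by rw [hK, hQv]; simp
    have h2 : b v = 0 := by rw [hb', hQv]; simp
    rw [h1, h2, map_zero, sub_zero] at h
    exact (mul_eq_zero.mp h).resolve_left hp0.ne'
  have hyQ : ∀ x, y (Q x) = y x := fun x => by rw [hQ, map_sub, map_smul, hyv]; simp
  have hyc : y c = p - a := by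
    have : y c = b (resolvent K p c) := rfl
    linarith
  -- The left eigenvector of `T` for `p`, normalized by `ξ v = 1`.
  let ξ : H →L[ℝ] ℝ := innerSL ℝ v + y
  have hξ : ∀ x, ξ x = inner ℝ v x + y x := fun x => by simp [ξ]
  have hdec : ∀ x, x = inner ℝ v x • v + Q x := fun x => by rw [hQ]; simp
  have hQT : ∀ x, Q (T x) = inner ℝ v x • c + K x := fun x => by
    conv_lhs => rw [hdec x]
    simp [hK, c]
  have hξT : ∀ x, ξ (T x) = p * ξ x := fun x => by
    have h1 : inner ℝ v (T x) = inner ℝ v x * a + b x := by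
      conv_lhs => rw [hdec x]
      rw [map_add, map_smul, inner_add_right, inner_smul_right, hb']
    have h2 : y (T x) = inner ℝ v x * (p - a) + y (K x) := by
      rw [← hyQ, hQT, map_add, map_smul, hyc, smul_eq_mul]
    rw [hξ, hξ, h1, h2]
    linarith [hyK x]
  have hξm : ∀ (m : ℕ) (x : H), ξ ((T ^ m) x) = p ^ m * ξ x := fun m x => by
    induction m with
    | zero => simp
    | succ m ih =>
      rw [pow_succ', mul_apply_eq_comp, hξT, ih]
      ring
  -- The intermediate value theorem only gives `p ≤ 1 + 2δ`; a contraction cannot scale a nonzero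
  -- functional by more than `1`.
  have hp1 : p ≤ 1 := by
    have h1 : ‖p • ξ‖ ≤ ‖ξ‖ := ContinuousLinearMap.opNorm_le_bound _ (norm_nonneg _) fun x => by
      have : (p • ξ) x = ξ (T x) := by rw [hξT]; simp
      rw [this]
      exact (ξ.le_opNorm _).trans (by gcongr; exact hT x)
    rw [norm_smul, Real.norm_of_nonneg hp0.le] at h1
    have h2 : 0 < ‖ξ‖ := by
      rw [norm_pos_iff]
      intro h
      have h3 := hξ v
      rw [h, hvv, hyv] at h3
      simp at h3
    nlinarith
  -- the component of the eigenvector that is orthogonal to `v`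
  let β : ℝ := y (R c)
  have hβ : |β| ≤ 1 / 8 := by
    have h1 := hy (R c)
    have h2 : |β| ≤ δ * ‖R (R c)‖ := hb _
    have h3 : η * ‖R (R c)‖ ≤ ‖R c‖ := hR p hp.1 _
    have h4 : η * ‖R c‖ ≤ ‖c‖ := hR p hp.1 _
    have h5 : η * ‖R c‖ ≤ η * (1 / 8) := by linarith
    have h6 := le_of_mul_le_mul_left h5 hη
    have h7 : |β| = |y (R c)| := rfl
    linarith
  have hβ1 : (7 : ℝ) / 8 ≤ 1 + β := by linarith [neg_abs_le β]
  -- The right eigenvector with `ξ = 1` is `(1 - y x₀) • v + x₀`. The `v^⊥` row of its eigenvalue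
  -- equation is `hx₀`, solved by a multiple of `R c`; the multiple is bounded because `|β| ≤ 1 /
  -- 8`.
  let x₀ : H := (1 + β)⁻¹ • R c
  have hx₀ : p • x₀ - K x₀ + y x₀ • c = c := by
    have h := smul_resolvent_sub K hKp c
    have h1 : p • x₀ - K x₀ = (1 + β)⁻¹ • c := by
      conv_rhs => rw [← h]
      simp only [x₀, map_smul, smul_sub]
      rw [smul_comm]
    have h2 : y x₀ = (1 + β)⁻¹ * β := by simp [x₀, β]
    rw [h1, h2, ← add_smul]
    have : (1 + β)⁻¹ + (1 + β)⁻¹ * β = 1 := by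
      have : 1 + β ≠ 0 := by linarith
      field_simp
    rw [this, one_smul]
  have hx₀n : ‖x₀‖ ≤ 1 / 7 := by
    have h4 : η * ‖R c‖ ≤ ‖c‖ := hR p hp.1 _
    have h5 : η * ‖R c‖ ≤ η * (1 / 8) := by linarith
    have h6 := le_of_mul_le_mul_left h5 hη
    have h7 : (1 + β)⁻¹ ≤ 8 / 7 := by
      rw [inv_le_comm₀ (by linarith) (by norm_num)]
      norm_num; linarith
    have h8 : 0 ≤ (1 + β)⁻¹ := inv_nonneg.mpr (by linarith)
    simp only [x₀, norm_smul, Real.norm_of_nonneg h8]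
    nlinarith [norm_nonneg (R c)]
  clear_value x₀
  refine ⟨p, ⟨hp.1, hp1⟩, fun z => ξ z • ((1 - y x₀) • v + x₀), fun m z => ?_⟩
  -- After subtracting the eigenvector part, the `v^⊥` component obeys the closed recursion `e ↦ K e
  -- - y e • c`, with factor at most `(γ + δ) + δ ≤ γ + 6δ`. Initially `‖e‖ ≤ (1 + 9/56) ‖z‖`.
  have he : ∀ m : ℕ, ‖Q ((T ^ m) z) - (p ^ m * ξ z) • x₀‖ ≤ (γ + 6 * δ) ^ m * (2 * ‖z‖) := by
    intro m
    induction m with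
    | zero =>
      have h1 : |ξ z| ≤ 9 / 8 * ‖z‖ := by
        rw [hξ]
        have := abs_add_le (inner ℝ v z) (y z)
        linarith [hiv z, hy z]
      have h2 := norm_sub_le (Q z) (ξ z • x₀)
      rw [norm_smul, Real.norm_eq_abs] at h2
      have h3 : |ξ z| * ‖x₀‖ ≤ (9 / 8 * ‖z‖) * (1 / 7) := by gcongr
      simp only [pow_zero, one_apply_eq_self, one_mul]
      linarith [hQn z, norm_nonneg z]
    | succ m ih =>
      set e := Q ((T ^ m) z) - (p ^ m * ξ z) • x₀ with he_def
      have hs : inner ℝ v ((T ^ m) z) = p ^ m * ξ z - y (Q ((T ^ m) z)) := by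
        rw [← hξm, hξ, hyQ]; ring
      have h1 : Q ((T ^ (m + 1)) z) - (p ^ (m + 1) * ξ z) • x₀ = K e - y e • c := by
        have hKQ : K ((T ^ m) z) = K (Q ((T ^ m) z)) := by rw [hK, hK, hQQ]
        rw [pow_succ', mul_apply_eq_comp, hQT, hs, hKQ, he_def, map_sub K, map_sub y,
          map_smul K, map_smul y]
        have h2 : K x₀ = p • x₀ + y x₀ • c - c := by
          rw [← sub_eq_zero]
          calc _ = -(p • x₀ - K x₀ + y x₀ • c - c) := by abel
            _ = 0 := by rw [hx₀]; simp
        rw [h2, smul_eq_mul]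
        module
      rw [h1]
      have h3 : ‖K e‖ ≤ (γ + δ) * ‖e‖ := K.le_of_opNorm_le hKn e
      have h4 := norm_sub_le (K e) (y e • c)
      rw [norm_smul, Real.norm_eq_abs] at h4
      have h5 : |y e| * ‖c‖ ≤ ‖e‖ * δ :=
        mul_le_mul (by linarith [hy e, abs_nonneg (y e)]) hc (norm_nonneg _) (norm_nonneg _)
      calc ‖K e - y e • c‖ ≤ (γ + 6 * δ) * ‖e‖ := by nlinarith [norm_nonneg e]
        _ ≤ (γ + 6 * δ) * ((γ + 6 * δ) ^ m * (2 * ‖z‖)) := by gcongr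
        _ = _ := by ring
  have h := he m
  set e := Q ((T ^ m) z) - (p ^ m * ξ z) • x₀ with he_def
  -- The component along `v` is recovered from `ξ`, so its error is `-y e`, at most `‖e‖ / 8`;
  -- altogether `(1 + 1/8) · 2 ≤ 3`.
  have h1 : (T ^ m) z - p ^ m • (ξ z • ((1 - y x₀) • v + x₀)) = e - y e • v := by
    have hs : inner ℝ v ((T ^ m) z) = p ^ m * ξ z - y (Q ((T ^ m) z)) := by
      rw [← hξm, hξ, hyQ]; ring
    conv_lhs => rw [hdec ((T ^ m) z)]
    rw [hs, he_def, map_sub y, map_smul y, smul_eq_mul]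
    module
  rw [h1]
  have h2 := norm_sub_le e (y e • v)
  rw [norm_smul, hv, Real.norm_eq_abs] at h2
  have h3 := hy e
  have : 0 ≤ (γ + 6 * δ) ^ m * (2 * ‖z‖) := by positivity
  linarith

/-- The version of `exists_dominant_eigenvalue` for operators on an invariant subspace. -/
theorem exists_dominant_eigenvalue_of_invariant {H : Type*} [NormedAddCommGroup H]
    [InnerProductSpace ℝ H] [FiniteDimensional ℝ H] (U : Submodule ℝ H) (T S : H →ₗ[ℝ] H)
    (hTU : ∀ x ∈ U, T x ∈ U) (hSU : ∀ x ∈ U, S x ∈ U) (v : H) (hvU : v ∈ U) (hv : v ≠ 0)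
    (γ δ : ℝ) (hγ : 0 ≤ γ) (hγ1 : γ < 1) (hδ : 0 ≤ δ) (hδγ : 11 * δ ≤ 1 - γ) (hSv : S v = v)
    (hvS : ∀ w ∈ U, inner ℝ v (S w) = inner ℝ v w)
    (hS : ∀ w ∈ U, inner ℝ v w = 0 → ‖S w‖ ≤ γ * ‖w‖) (hT : ∀ w ∈ U, ‖T w‖ ≤ ‖w‖)
    (hTS : ∀ w ∈ U, ‖T w - S w‖ ≤ δ * ‖w‖) :
    ∃ p ∈ Set.Icc (1 - 2 * δ) 1, ∀ x ∈ U, ∃ y : H, ∀ m : ℕ,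
      ‖(T ^ m) x - p ^ m • y‖ ≤ 3 * (γ + 6 * δ) ^ m * ‖x‖ := by
  let T' : U →L[ℝ] U := LinearMap.toContinuousLinearMap (T.restrict hTU)
  let S' : U →L[ℝ] U := LinearMap.toContinuousLinearMap (S.restrict hSU)
  have hpow : ∀ (m : ℕ) (x : U), ((T' ^ m) x : H) = (T ^ m) x := fun m x => by
    induction m with
    | zero => rfl
    | succ m ih =>
      rw [pow_succ', pow_succ', mul_apply_eq_comp, Module.End.mul_apply, ← ih]
      rfl
  let w : U := ⟨v, hvU⟩
  have hw : ‖w‖ ≠ 0 := norm_ne_zero_iff.mpr fun h => hv (congrArg Subtype.val h)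
  have hSw : S' w = w := Subtype.ext hSv
  obtain ⟨p, hp, Q, hQ⟩ := exists_dominant_eigenvalue T' S' (‖w‖⁻¹ • w)
    (by rw [norm_smul, norm_inv, norm_norm, inv_mul_cancel₀ hw]) γ δ hγ hγ1 hδ hδγ
    (by rw [map_smul, hSw])
    (fun x => by
      rw [real_inner_smul_left, real_inner_smul_left]
      congr 1
      exact hvS x x.2)
    (fun x hx => by
      rw [real_inner_smul_left] at hx
      exact hS x x.2 ((mul_eq_zero.mp hx).resolve_left (inv_ne_zero hw)))
    (fun x => hT x x.2) (fun x => hTS x x.2)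
  refine ⟨p, hp, fun x hx => ⟨Q ⟨x, hx⟩, fun m => ?_⟩⟩
  have h := hQ m ⟨x, hx⟩
  rw [← Submodule.norm_coe, Submodule.coe_sub, hpow] at h
  exact h

/-! ### Superoperators as vectors of the Hilbert-Schmidt space -/

/-- Coordinates of a superoperator: first the matrix entry of the value, then the matrix unit it is
evaluated at. -/
abbrev Idx (n : ℕ) : Type := (Bits n × Bits n) × (Bits n × Bits n)

/-- The Hilbert space of superoperators. -/
abbrev HS (n : ℕ) : Type := EuclideanSpace ℂ (Idx n)

/-- A superoperator is determined by its values on the matrix units. -/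
def vec {n : ℕ} : Superop n ≃ₗ[ℂ] HS n where
  toFun C := WithLp.toLp 2 fun q => C (Matrix.single q.2.1 q.2.2 1) q.1.1 q.1.2
  map_add' C D := by ext q; simp
  map_smul' c C := by ext q; simp
  invFun x :=
    { toFun := fun X => Matrix.of fun k l => ∑ i, ∑ j, X i j * x ((k, l), (i, j))
      map_add' := fun X Y => by
        ext k l
        simp [add_mul, Finset.sum_add_distrib]
      map_smul' := fun c X => by
        ext k l
        simp [mul_assoc, Finset.mul_sum] }
  left_inv C := by
    ext X k l : 3
    conv_rhs => rw [Matrix.matrix_eq_sum_single X]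
    simp only [map_sum, LinearMap.coe_mk, AddHom.coe_mk, Matrix.of_apply, Matrix.sum_apply]
    refine Finset.sum_congr rfl fun i _ => Finset.sum_congr rfl fun j _ => ?_
    have : Matrix.single i j (X i j) = X i j • Matrix.single i j (1 : ℂ) := by simp
    rw [this, map_smul]
    rfl
  right_inv x := by
    ext q
    simp [Matrix.single_apply, ite_and]

lemma vec_apply {n : ℕ} (C : Superop n) (q : Idx n) :
    vec C q = C (Matrix.single q.2.1 q.2.2 1) q.1.1 q.1.2 := rfl

lemma apply_eq_sum_vec {n : ℕ} (C : Superop n) (X : Op n) (k l : Bits n) :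
    C X k l = ∑ i, ∑ j, X i j * vec C ((k, l), (i, j)) := by
  conv_lhs => rw [← vec.symm_apply_apply C]
  rfl

lemma norm_vec {n : ℕ} (C : Superop n) : ‖vec C‖ = hsNorm C := by
  rw [EuclideanSpace.norm_eq, hsNorm, Fintype.sum_prod_type, Finset.sum_comm,
    Fintype.sum_prod_type]
  simp only [Fintype.sum_prod_type, vec_apply]

/-- The matrix of a superoperator. -/
def liou {n : ℕ} (C : Superop n) : Matrix (Bits n × Bits n) (Bits n × Bits n) ℂ :=
  Matrix.of fun p q => vec C (p, q)

lemma liou_comp {n : ℕ} (C D : Superop n) : liou (C ∘ₗ D) = liou C * liou D := by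
  ext p q
  rw [Matrix.mul_apply, Fintype.sum_prod_type]
  simp only [liou, Matrix.of_apply, vec_apply, LinearMap.comp_apply]
  rw [apply_eq_sum_vec C]
  simp only [vec_apply, mul_comm]

lemma omega_apply {n : ℕ} (g : SU n) (X : Op n) : omega g X = (g : Op n) * X * (g : Op n)ᴴ := rfl

lemma omega_one {n : ℕ} : omega (1 : SU n) = LinearMap.id := by
  ext X : 1
  simp [omega_apply]

lemma omega_mul {n : ℕ} (g h : SU n) : omega (g * h) = omega g ∘ₗ omega h := by
  ext X : 1
  simp [omega_apply, Matrix.mul_assoc]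

lemma omega_inv_comp {n : ℕ} (g : SU n) : omega g⁻¹ ∘ₗ omega g = LinearMap.id := by
  rw [← omega_mul, inv_mul_cancel, omega_one]

lemma omega_comp_inv {n : ℕ} (g : SU n) : omega g ∘ₗ omega g⁻¹ = LinearMap.id := by
  rw [← omega_mul, mul_inv_cancel, omega_one]

/-- Makes `liou (omega g)` a unitary matrix, so that composing with a unitary channel on either side
preserves the Hilbert-Schmidt norm. -/
lemma liou_omega_inv {n : ℕ} (g : SU n) : liou (omega g⁻¹) = (liou (omega g))ᴴ := by
  ext p q
  simp [liou, vec_apply, omega_apply, SU.coe_inv, Matrix.mul_apply, Matrix.single_apply, ite_and,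
    mul_comm]

lemma liou_id {n : ℕ} : liou (LinearMap.id : Superop n) = 1 := by
  ext p q
  simp only [liou, Matrix.of_apply, vec_apply, LinearMap.id_apply, Matrix.single_apply,
    Matrix.one_apply, Prod.ext_iff]
  simp only [eq_comm]

lemma hsNorm_sq {n : ℕ} (C : Superop n) : hsNorm C ^ 2 = (liou C * (liou C)ᴴ).trace.re := by
  rw [← norm_vec, EuclideanSpace.norm_sq_eq, Fintype.sum_prod_type]
  simp [Matrix.trace, Matrix.mul_apply, liou, Complex.mul_conj, Complex.normSq_eq_norm_sq,
    -Complex.ofReal_pow, Complex.ofReal_re]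

lemma hsNorm_nonneg {n : ℕ} (C : Superop n) : 0 ≤ hsNorm C := Real.sqrt_nonneg _

lemma hsNorm_comp_omega {n : ℕ} (C : Superop n) (g : SU n) : hsNorm (C ∘ₗ omega g) = hsNorm C := by
  rw [← sq_eq_sq₀ (hsNorm_nonneg _) (hsNorm_nonneg _), hsNorm_sq, hsNorm_sq, liou_comp,
    conjTranspose_mul, ← liou_omega_inv]
  congr 2
  calc _ = liou C * (liou (omega g) * liou (omega g⁻¹)) * (liou C)ᴴ := by
        simp only [Matrix.mul_assoc]
    _ = _ := by rw [← liou_comp, omega_comp_inv, liou_id, Matrix.mul_one]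

lemma hsNorm_omega_comp {n : ℕ} (C : Superop n) (g : SU n) : hsNorm (omega g ∘ₗ C) = hsNorm C := by
  rw [← sq_eq_sq₀ (hsNorm_nonneg _) (hsNorm_nonneg _), hsNorm_sq, hsNorm_sq, liou_comp,
    conjTranspose_mul, ← liou_omega_inv]
  congr 1
  rw [Matrix.mul_assoc, Matrix.trace_mul_comm]
  calc _ = (liou C * (liou C)ᴴ * (liou (omega g⁻¹) * liou (omega g))).trace := by
        simp only [Matrix.mul_assoc]
    _ = _ := by rw [← liou_comp, omega_inv_comp, liou_id, Matrix.mul_one]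

/-! ### The trace norm -/

section traceNorm

variable {ι : Type} [Fintype ι] [DecidableEq ι]

open scoped MatrixOrder Matrix.Norms.L2Operator

/-- The functional calculus replaces a choice of eigenvalues, giving access to continuity in `X` and
to uniqueness of the positive square root. -/
lemma traceNorm_eq_trace_sqrt (X : Matrix ι ι ℂ) :
    traceNorm X = (CFC.sqrt (Xᴴ * X)).trace.re := by
  have h0 : 0 ≤ Xᴴ * X := (posSemidef_conjTranspose_mul_self X).nonneg
  rw [CFC.sqrt_eq_real_sqrt _ h0, cfcₙ_eq_cfc,
    (isHermitian_conjTranspose_mul_self X).cfc_eq, IsHermitian.cfc,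
    Unitary.conjStarAlgAut_apply, Matrix.trace_mul_cycle]
  simp [traceNorm, Matrix.trace]

lemma continuous_traceNorm : Continuous (traceNorm : Matrix ι ι ℂ → ℝ) := by
  have h : (traceNorm : Matrix ι ι ℂ → ℝ) = fun X => (CFC.sqrt (Xᴴ * X)).trace.re :=
    funext traceNorm_eq_trace_sqrt
  rw [h]
  refine Complex.continuous_re.comp (Continuous.matrix_trace ?_)
  refine CFC.continuousOn_sqrt.comp_continuous
    (continuous_id.matrix_conjTranspose.matrix_mul continuous_id) fun X => ?_
  exact (posSemidef_conjTranspose_mul_self X).nonneg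

lemma traceNorm_eq_of_mul_self_eq {X P : Matrix ι ι ℂ} (hP : P.PosSemidef)
    (h : P * P = Xᴴ * X) : traceNorm X = P.trace.re := by
  rw [traceNorm_eq_trace_sqrt, CFC.sqrt_unique h hP.nonneg]

lemma exists_posSemidef_traceNorm (X : Matrix ι ι ℂ) :
    ∃ P : Matrix ι ι ℂ, P.PosSemidef ∧ P * P = Xᴴ * X ∧ traceNorm X = P.trace.re :=
  ⟨CFC.sqrt (Xᴴ * X), (CFC.sqrt_nonneg _).posSemidef,
    CFC.sqrt_mul_sqrt_self _ (posSemidef_conjTranspose_mul_self X).nonneg,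
    traceNorm_eq_trace_sqrt X⟩

end traceNorm

section

lemma trace_conjTranspose_mul_self_re {ι : Type} [Fintype ι] (X : Matrix ι ι ℂ) :
    (Xᴴ * X).trace.re = ∑ i, ∑ j, ‖X i j‖ ^ 2 := by
  rw [Finset.sum_comm]
  simp [Matrix.trace, Matrix.mul_apply, Complex.normSq_apply, Complex.sq_norm]

variable {ι : Type} [Fintype ι] [DecidableEq ι]

lemma traceNorm_nonneg (X : Matrix ι ι ℂ) : 0 ≤ traceNorm X :=
  Finset.sum_nonneg fun _ _ => Real.sqrt_nonneg _

lemma traceNorm_smul_conj (c : ℂ) (W X : Matrix ι ι ℂ) (hW : Wᴴ * W = 1) :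
    traceNorm (c • (W * X * Wᴴ)) = ‖c‖ * traceNorm X := by
  obtain ⟨P, hP, hPX, hX⟩ := exists_posSemidef_traceNorm X
  have h1 : (((‖c‖ : ℝ) : ℂ) • (W * P * Wᴴ)).PosSemidef :=
    (hP.mul_mul_conjTranspose_same W).smul (by exact_mod_cast norm_nonneg c)
  rw [traceNorm_eq_of_mul_self_eq h1, Matrix.trace_smul, Matrix.trace_mul_cycle, hW,
    Matrix.one_mul, hX, smul_eq_mul, Complex.re_ofReal_mul]
  have h2 : ∀ A B : Matrix ι ι ℂ, (W * A * Wᴴ) * (W * B * Wᴴ) = W * (A * B) * Wᴴ := fun A B => by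
    calc _ = W * A * (Wᴴ * W) * B * Wᴴ := by simp only [Matrix.mul_assoc]
      _ = _ := by rw [hW]; simp only [Matrix.mul_assoc, Matrix.mul_one]
  have h3 : (W * X * Wᴴ)ᴴ = W * Xᴴ * Wᴴ := by
    simp [conjTranspose_mul, Matrix.mul_assoc]
  rw [conjTranspose_smul, h3, smul_mul_smul_comm, smul_mul_smul_comm, h2, h2, hPX]
  congr 1
  rw [← Complex.ofReal_mul, Complex.norm_mul_self_eq_normSq, Complex.normSq_eq_conj_mul_self]
  rfl

lemma sum_norm_sq_le_traceNorm_sq (X : Matrix ι ι ℂ) :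
    ∑ i, ∑ j, ‖X i j‖ ^ 2 ≤ traceNorm X ^ 2 := by
  have hH := isHermitian_conjTranspose_mul_self X
  have h0 := (posSemidef_conjTranspose_mul_self X).eigenvalues_nonneg
  have h : ∑ i, ∑ j, ‖X i j‖ ^ 2 = ∑ i, Real.sqrt (hH.eigenvalues i) ^ 2 := by
    rw [← trace_conjTranspose_mul_self_re, hH.trace_eq_sum_eigenvalues]
    simp only [Real.sq_sqrt (h0 _)]
    simp
  rw [h]
  exact Finset.sum_sq_le_sq_sum_of_nonneg fun i _ => Real.sqrt_nonneg _

lemma norm_apply_le_traceNorm (X : Matrix ι ι ℂ) (i j : ι) : ‖X i j‖ ≤ traceNorm X := by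
  refine abs_le_of_sq_le_sq' ?_ (traceNorm_nonneg X) |>.2
  refine le_trans ?_ (sum_norm_sq_le_traceNorm_sq X)
  calc ‖X i j‖ ^ 2 ≤ ∑ j, ‖X i j‖ ^ 2 :=
        Finset.single_le_sum (f := fun j => ‖X i j‖ ^ 2) (fun _ _ => by positivity)
          (Finset.mem_univ j)
    _ ≤ _ := Finset.single_le_sum (f := fun i => ∑ j, ‖X i j‖ ^ 2) (fun _ _ => by positivity)
          (Finset.mem_univ i)

lemma isCompact_traceNorm_le_one : IsCompact {X : Matrix ι ι ℂ | traceNorm X ≤ 1} := by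
  have hK : IsCompact (Set.pi Set.univ fun _ : ι =>
      Set.pi Set.univ fun _ : ι => Metric.closedBall (0 : ℂ) 1) :=
    isCompact_univ_pi fun _ => isCompact_univ_pi fun _ => isCompact_closedBall _ _
  refine IsCompact.of_isClosed_subset hK (isClosed_le continuous_traceNorm continuous_const) ?_
  intro X hX i _ j _
  rw [mem_closedBall_zero_iff]
  exact (norm_apply_le_traceNorm X i j).trans hX

end

/-! ### The diamond distance of unitary channels -/

lemma continuous_coe_SU {n : ℕ} : Continuous fun g : SU n => (g : Op n) := continuous_subtype_val

lemma continuous_omega_apply {n : ℕ} {α : Type*} [TopologicalSpace α] {X : α → Op n}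
    {g : α → SU n} (hX : Continuous X) (hg : Continuous g) :
    Continuous fun t => omega (g t) (X t) :=
  ((continuous_coe_SU.comp hg).matrix_mul hX).matrix_mul
    (continuous_coe_SU.comp hg).matrix_conjTranspose

lemma continuous_traceNorm_amplify {n : ℕ} (g : SU n) :
    Continuous fun t : SU n × Matrix (Bits n × Bits n) (Bits n × Bits n) ℂ =>
      traceNorm (amplify (Bits n) (omega g - omega t.1) t.2) := by
  refine continuous_traceNorm.comp (continuous_matrix fun p q => ?_)
  have hX : Continuous fun t : SU n × Matrix (Bits n × Bits n) (Bits n × Bits n) ℂ =>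
      (Matrix.of fun i j => t.2 (p.1, i) (q.1, j) : Op n) :=
    continuous_matrix fun i j => continuous_snd.matrix_elem _ _
  exact ((continuous_omega_apply hX continuous_const).sub
    (continuous_omega_apply hX continuous_fst)).matrix_elem _ _

/-- Compactness of `SU n` and of the trace-norm ball bounds the sets whose suprema are the diamond
norms, uniformly in `u`; an unbounded set would have `sSup` equal to `0`. -/
lemma exists_traceNorm_amplify_le {n : ℕ} (g : SU n) :
    ∃ c : ℝ, ∀ (u : SU n) (X : Matrix (Bits n × Bits n) (Bits n × Bits n) ℂ), traceNorm X ≤ 1 →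
      traceNorm (amplify (Bits n) (omega g - omega u) X) ≤ c := by
  obtain ⟨c, hc⟩ := ((isCompact_univ (X := SU n)).prod
    (isCompact_traceNorm_le_one (ι := Bits n × Bits n))).bddAbove_image
      (continuous_traceNorm_amplify g).continuousOn
  exact ⟨c, fun u X hX => hc ⟨(u, X), ⟨Set.mem_univ _, hX⟩, rfl⟩⟩

lemma le_diamondNorm {n : ℕ} (g u : SU n) (X : Matrix (Bits n × Bits n) (Bits n × Bits n) ℂ)
    (hX : traceNorm X ≤ 1) :
    traceNorm (amplify (Bits n) (omega g - omega u) X) ≤ diamondNorm (omega g - omega u) := by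
  obtain ⟨c, hc⟩ := exists_traceNorm_amplify_le g
  refine le_csSup ⟨c, ?_⟩ ⟨X, hX, rfl⟩
  rintro r ⟨Y, hY, rfl⟩
  exact hc u Y hY

lemma diamondNorm_nonneg {n : ℕ} (Φ : Superop n) : 0 ≤ diamondNorm Φ := by
  refine Real.sSup_nonneg ?_
  rintro r ⟨X, -, rfl⟩
  exact traceNorm_nonneg _

lemma traceNorm_zero {ι : Type} [Fintype ι] [DecidableEq ι] :
    traceNorm (0 : Matrix ι ι ℂ) = 0 := by
  rw [traceNorm_eq_of_mul_self_eq (P := 0) PosSemidef.zero (by simp)]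
  simp

/-- A supremum of continuous functions is lower semicontinuous. -/
lemma measurable_diamondNorm_omega_sub {n : ℕ} (g : SU n) :
    Measurable fun u : SU n => diamondNorm (omega g - omega u) := by
  refine LowerSemicontinuous.measurable ?_
  have h : (fun u : SU n => diamondNorm (omega g - omega u)) = fun u => ⨆ X :
      {X : Matrix (Bits n × Bits n) (Bits n × Bits n) ℂ // traceNorm X ≤ 1},
      traceNorm (amplify (Bits n) (omega g - omega u) X) := by
    ext u
    rw [iSup, diamondNorm]
    congr 1
    ext r
    simp [eq_comm]
  rw [h]
  refine lowerSemicontinuous_ciSup (fun u => ?_) fun X => ?_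
  · obtain ⟨c, hc⟩ := exists_traceNorm_amplify_le g
    refine ⟨c, ?_⟩
    rintro r ⟨X, rfl⟩
    exact hc u X X.2
  · exact ((continuous_traceNorm_amplify g).comp
      (continuous_id.prodMk continuous_const)).lowerSemicontinuous

lemma integrable_diamondNorm_omega_sub {n : ℕ} (g : SU n) (ν : Measure (SU n))
    [IsFiniteMeasure ν] : Integrable (fun u => diamondNorm (omega g - omega u)) ν := by
  obtain ⟨c, hc⟩ := exists_traceNorm_amplify_le g
  refine Integrable.of_bound (measurable_diamondNorm_omega_sub g).aestronglyMeasurable c ?_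
  filter_upwards with u
  rw [Real.norm_of_nonneg (diamondNorm_nonneg _)]
  refine csSup_le ⟨_, 0, by simp [traceNorm_zero], rfl⟩ ?_
  rintro r ⟨X, hX, rfl⟩
  exact hc u X hX

/-! ### The Hilbert-Schmidt norm against the diamond norm -/

/-- Composition with a unitary channel on the right, as an isometry. -/
def rightMul {n : ℕ} (h : SU n) : HS n ≃ₗᵢ[ℂ] HS n where
  toFun x := vec (vec.symm x ∘ₗ omega h)
  map_add' x y := by rw [map_add, LinearMap.add_comp, map_add]
  map_smul' c x := by rw [map_smul, LinearMap.smul_comp, map_smul, RingHom.id_apply]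
  invFun x := vec (vec.symm x ∘ₗ omega h⁻¹)
  left_inv x := by
    beta_reduce
    rw [LinearEquiv.symm_apply_apply, LinearMap.comp_assoc, omega_comp_inv, LinearMap.comp_id,
      LinearEquiv.apply_symm_apply]
  right_inv x := by
    beta_reduce
    rw [LinearEquiv.symm_apply_apply, LinearMap.comp_assoc, omega_inv_comp, LinearMap.comp_id,
      LinearEquiv.apply_symm_apply]
  norm_map' x := by
    change ‖vec (vec.symm x ∘ₗ omega h)‖ = ‖x‖
    rw [norm_vec, hsNorm_comp_omega, ← norm_vec, LinearEquiv.apply_symm_apply]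

lemma rightMul_apply {n : ℕ} (h : SU n) (x : HS n) :
    rightMul h x = vec (vec.symm x ∘ₗ omega h) := rfl

/-- The normal superoperator `ω(h) - 1` attains its norm at an eigenvector. -/
lemma exists_eigenvector_omega {n : ℕ} (h : SU n) :
    ∃ (c : ℂ) (X : Op n), X ≠ 0 ∧ omega h X - X = c • X ∧
      ∀ D : Superop n, hsNorm (D ∘ₗ omega h - D) ≤ ‖c‖ * hsNorm D := by
  let u : unitary (HS n →L[ℂ] HS n) := Unitary.linearIsometryEquiv.symm (rightMul h)
  have hu : ∀ x, (u : HS n →L[ℂ] HS n) x = rightMul h x := fun x => by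
    simp only [u, Unitary.coe_symm_linearIsometryEquiv_apply]
    rfl
  let a : HS n →L[ℂ] HS n := u - 1
  have ha : IsStarNormal a := by
    have h1 : star (u : HS n →L[ℂ] HS n) * u = 1 := Unitary.coe_star_mul_self u
    have h2 : (u : HS n →L[ℂ] HS n) * star (u : HS n →L[ℂ] HS n) = 1 := Unitary.coe_mul_star_self u
    have h3 : star a = star (u : HS n →L[ℂ] HS n) - 1 :=
      (star_sub (u : HS n →L[ℂ] HS n) 1).trans (by rw [star_one])
    refine ⟨?_⟩
    rw [h3]
    simp only [a, Commute, SemiconjBy, mul_sub, sub_mul, h1, h2, mul_one, one_mul]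
    abel
  -- For a normal operator the spectral radius is the norm, and it is attained in the spectrum.
  obtain ⟨c, hc, hcn⟩ := spectrum.exists_nnnorm_eq_spectralRadius a
  rw [ha.spectralRadius_eq_nnnorm] at hcn
  have hcn' : ‖c‖ = ‖a‖ := by
    have := ENNReal.coe_injective hcn
    exact congrArg NNReal.toReal this
  let N : Superop n := omega h - LinearMap.id - c • LinearMap.id
  -- `c` lies in the spectrum of right composition, while an eigenvector of `ω(h) - 1` itself is
  -- wanted. If `N` were injective it would be surjective, so right composition with `N` would be
  -- injective, hence invertible in finite dimension.
  have hN : ¬ Function.Injective N := by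
    intro hinj
    have hsurj : Function.Surjective N := LinearMap.injective_iff_surjective.mp hinj
    apply hc
    have hb : Function.Injective (algebraMap ℂ (HS n →L[ℂ] HS n) c - a) := by
      rw [injective_iff_map_eq_zero]
      intro x hx
      have h3 : vec.symm x ∘ₗ N = 0 := by
        apply vec.injective
        have h4 : c • x - (rightMul h x - x) = 0 := by
          rw [← hu]
          simpa [a, Algebra.algebraMap_eq_smul_one] using hx
        rw [map_zero, ← neg_zero, ← h4, rightMul_apply]
        simp only [N, LinearMap.comp_sub, LinearMap.comp_smul, LinearMap.comp_id, map_sub,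
          map_smul, LinearEquiv.apply_symm_apply]
        abel
      have h5 : vec.symm x = 0 := by
        ext Y : 1
        obtain ⟨Z, rfl⟩ := hsurj Y
        simpa using congrArg (fun D : Superop n => D Z) h3
      simpa using h5
    rw [spectrum.mem_resolventSet_iff, ContinuousLinearMap.isUnit_iff_bijective]
    refine ⟨hb, ?_⟩
    exact (LinearMap.injective_iff_surjective
      (f := (algebraMap ℂ (HS n →L[ℂ] HS n) c - a : HS n →L[ℂ] HS n).toLinearMap)).mp hb
  rw [injective_iff_map_eq_zero] at hN
  push Not at hN
  obtain ⟨X, hX, hX0⟩ := hN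
  refine ⟨c, X, hX0, ?_, fun D => ?_⟩
  · simpa [N, sub_eq_zero] using hX
  · have h6 := a.le_opNorm (vec D)
    have h7 : a (vec D) = vec (D ∘ₗ omega h - D) := by
      simp [a, hu, rightMul_apply]
    rw [h7, norm_vec, norm_vec, ← hcn'] at h6
    exact h6

open scoped Kronecker in
lemma amplify_kronecker {n : ℕ} (Φ : Superop n) (A : Op n) (X : Op n) :
    amplify (Bits n) Φ (A ⊗ₖ X) = A ⊗ₖ Φ X := by
  ext p q
  have : (Matrix.of fun i j => (A ⊗ₖ X) (p.1, i) (q.1, j) : Op n) = A p.1 q.1 • X := by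
    ext i j
    simp
  rw [amplify, Matrix.of_apply, this, map_smul]
  simp

lemma coe_SU_conjTranspose_mul {n : ℕ} (g : SU n) : (g : Op n)ᴴ * (g : Op n) = 1 := by
  exact congrArg (fun h : SU n => (h : Op n)) (inv_mul_cancel g)

open scoped Kronecker in
/-- For differences of unitary channels the Hilbert-Schmidt operator norm is at most the diamond
norm. -/
lemma hsNorm_comp_omega_sub_le {n : ℕ} (D : Superop n) (g u : SU n) :
    hsNorm (D ∘ₗ (omega u - omega g)) ≤ diamondNorm (omega g - omega u) * hsNorm D := by
  obtain ⟨c, X, hX0, hX, hD⟩ := exists_eigenvector_omega (u * g⁻¹)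
  have h1 : D ∘ₗ (omega u - omega g) = (D ∘ₗ omega (u * g⁻¹) - D) ∘ₗ omega g := by
    rw [LinearMap.sub_comp, LinearMap.comp_assoc, ← omega_mul, inv_mul_cancel_right,
      LinearMap.comp_sub]
  rw [h1, hsNorm_comp_omega]
  refine (hD D).trans (mul_le_mul_of_nonneg_right ?_ (hsNorm_nonneg D))
  let Y : Op n := omega g⁻¹ X
  have hY : omega g Y = X := by
    have := congrArg (fun C : Superop n => C X) (omega_comp_inv g)
    exact this
  have hgu : (omega g - omega u) Y = (-c) • omega g Y := by
    have h2 : omega u Y = omega (u * g⁻¹) X := by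
      rw [omega_mul]; rfl
    rw [LinearMap.sub_apply, h2, hY, neg_smul, ← hX]
    abel
  -- With the ancilla in a pure state, the amplified difference sends `Z` to `-c` times a unitary
  -- conjugate of `Z`. Its trace norm is scaled by exactly `‖c‖`, which the diamond norm therefore
  -- dominates.
  let Z : Matrix (Bits n × Bits n) (Bits n × Bits n) ℂ :=
    Matrix.single (zeroBits n) (zeroBits n) 1 ⊗ₖ Y
  have hZ : amplify (Bits n) (omega g - omega u) Z
      = (-c) • (((1 : Op n) ⊗ₖ (g : Op n)) * Z * ((1 : Op n) ⊗ₖ (g : Op n))ᴴ) := by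
    simp only [Z]
    rw [amplify_kronecker, hgu, omega_apply, conjTranspose_kronecker, conjTranspose_one,
      ← mul_kronecker_mul, ← mul_kronecker_mul, Matrix.one_mul, Matrix.mul_one, kronecker_smul]
  have hW : ((1 : Op n) ⊗ₖ (g : Op n))ᴴ * ((1 : Op n) ⊗ₖ (g : Op n)) = 1 := by
    rw [conjTranspose_kronecker, conjTranspose_one, ← mul_kronecker_mul, Matrix.one_mul,
      coe_SU_conjTranspose_mul, one_kronecker_one]
  have hZ0 : 0 < traceNorm Z := by
    refine lt_of_le_of_ne (traceNorm_nonneg Z) fun h0 => hX0 ?_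
    have hY0 : Y = 0 := by
      ext i j
      have := norm_apply_le_traceNorm Z (zeroBits n, i) (zeroBits n, j)
      rw [← h0] at this
      simpa [Z] using this
    rw [← hY, hY0, map_zero]
  let t : ℂ := ((traceNorm Z)⁻¹ : ℝ)
  have ht : traceNorm (t • Z) = 1 := by
    have := traceNorm_smul_conj t 1 Z (by simp)
    rw [conjTranspose_one, Matrix.one_mul, Matrix.mul_one] at this
    rw [this, Complex.norm_real, Real.norm_of_nonneg (inv_nonneg.mpr hZ0.le),
      inv_mul_cancel₀ hZ0.ne']
  have h3 := le_diamondNorm g u (t • Z) ht.le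
  have h4 : amplify (Bits n) (omega g - omega u) (t • Z)
      = (-c) • (((1 : Op n) ⊗ₖ (g : Op n)) * (t • Z) * ((1 : Op n) ⊗ₖ (g : Op n))ᴴ) := by
    rw [Matrix.mul_smul, Matrix.smul_mul, smul_comm, ← hZ]
    ext p q
    simp only [amplify, Matrix.of_apply, Matrix.smul_apply]
    rw [← Matrix.smul_apply, ← map_smul]
    rfl
  rwa [h4, traceNorm_smul_conj _ _ _ hW, ht, mul_one, norm_neg] at h3

/-! ### Superoperators commuting with all unitary channels -/

/-- Every unitary is a phase times an element of `SU(2 ^ n)`. -/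
lemma exists_omega_eq {n : ℕ} (V : Op n) (hV : Vᴴ * V = 1) :
    ∃ g : SU n, ∀ X, omega g X = V * X * Vᴴ := by
  have hV' : V * Vᴴ = 1 := mul_eq_one_comm.mp hV
  have hdet : ‖V.det‖ = 1 := by
    have h := congrArg Matrix.det hV
    rw [det_mul, det_conjTranspose, det_one] at h
    have h1 := congrArg norm h
    rw [norm_mul, norm_star, norm_one] at h1
    nlinarith [norm_nonneg V.det]
  have hcard : Fintype.card (Bits n) ≠ 0 := Fintype.card_ne_zero
  obtain ⟨ζ, hζ⟩ := IsAlgClosed.exists_pow_nat_eq V.det⁻¹ (Nat.pos_of_ne_zero hcard)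
  have hζ1 : ‖ζ‖ = 1 := by
    have h := congrArg norm hζ
    rw [norm_pow, norm_inv, hdet, inv_one] at h
    exact (pow_eq_one_iff_of_nonneg (norm_nonneg ζ) hcard).mp h
  have hζζ : ζ * star ζ = 1 := by
    have := Complex.mul_conj' ζ
    rw [hζ1] at this
    simpa using this
  have hmem : ζ • V ∈ Matrix.specialUnitaryGroup (Bits n) ℂ := by
    rw [mem_specialUnitaryGroup_iff, mem_unitaryGroup_iff, star_eq_conjTranspose,
      conjTranspose_smul, smul_mul_smul_comm, hζζ, hV', det_smul, hζ]
    refine ⟨one_smul _ _, inv_mul_cancel₀ ?_⟩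
    rw [← norm_ne_zero_iff, hdet]
    exact one_ne_zero
  refine ⟨⟨ζ • V, hmem⟩, fun X => ?_⟩
  rw [omega_apply]
  change ζ • V * X * (ζ • V)ᴴ = _
  rw [conjTranspose_smul, Matrix.smul_mul, smul_mul_smul_comm, hζζ, one_smul]

/-- A superoperator commutes with all unitary channels. -/
def IsCovariant {n : ℕ} (C : Superop n) : Prop :=
  ∀ (g : SU n) (X : Op n), C (omega g X) = omega g (C X)

/-- Passes from the group to the Lie algebra without differentiating: for the unitaries `1 + (±i -
1) P`, the difference of the two channels is exactly `2i [P, ·]`. -/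
lemma IsCovariant.lie_of_projection {n : ℕ} {C : Superop n} (hC : IsCovariant C) (P : Op n)
    (hP : Pᴴ = P) (hPP : P * P = P) (X : Op n) : C (P * X - X * P) = P * C X - C X * P := by
  have key : ∀ s : ℂ, s * s = -1 → star s = -s →
      ∃ g : SU n, ∀ Y : Op n, omega g Y
        = (Y - P * Y - Y * P + (2 : ℂ) • (P * Y * P)) + s • (P * Y - Y * P) := by
    intro s hs hs'
    have hVs : (1 + (s - 1) • P)ᴴ = 1 + (-s - 1) • P := by
      rw [conjTranspose_add, conjTranspose_one, conjTranspose_smul, hP, star_sub, hs', star_one]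
    have hexp : ∀ Y : Op n, (1 + (s - 1) • P) * Y * (1 + (-s - 1) • P)
        = (Y - P * Y - Y * P + (2 : ℂ) • (P * Y * P)) + s • (P * Y - Y * P) := fun Y => by
      have h2 : (s - 1) * (-s - 1) = 2 := by linear_combination -hs
      have h1 : (1 + (s - 1) • P) * Y * (1 + (-s - 1) • P)
          = Y + (s - 1) • (P * Y) + (-s - 1) • (Y * P)
            + ((s - 1) * (-s - 1)) • (P * Y * P) := by
        simp only [add_mul, mul_add, Matrix.one_mul, Matrix.mul_one, Matrix.smul_mul,
          Matrix.mul_smul, smul_smul]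
        module
      rw [h1, h2]
      module
    obtain ⟨g, hg⟩ := exists_omega_eq (1 + (s - 1) • P) (by
      rw [hVs]
      have h2 : (-s - 1) * (s - 1) = 2 := by linear_combination -hs
      have h1 : (1 + (-s - 1) • P) * (1 + (s - 1) • P)
          = 1 + (s - 1) • P + (-s - 1) • P + ((-s - 1) * (s - 1)) • (P * P) := by
        simp only [add_mul, mul_add, Matrix.one_mul, Matrix.mul_one, Matrix.smul_mul,
          Matrix.mul_smul, smul_smul]
        module
      rw [h1, h2, hPP]
      module)
    refine ⟨g, fun Y => ?_⟩
    rw [hg, hVs, hexp]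
  obtain ⟨g, hg⟩ := key Complex.I Complex.I_mul_I (by simp)
  obtain ⟨g', hg'⟩ := key (-Complex.I) (by simp) (by simp)
  have h1 : C (omega g X - omega g' X) = omega g (C X) - omega g' (C X) := by
    rw [map_sub, hC, hC]
  have h2 : ∀ Y : Op n, omega g Y - omega g' Y = (2 * Complex.I) • (P * Y - Y * P) := fun Y => by
    rw [hg, hg']
    module
  rw [h2, h2, map_smul] at h1
  exact smul_right_injective _ (by simp : (2 * Complex.I) ≠ 0) h1

/-- Both sides are linear in `K`, and projections span all matrices: the diagonal units, and the
rank-one projections onto `(e_k + s̄ e_l) / √2` with `s = 1, i`, whose combinations isolate the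
off-diagonal units. -/
lemma IsCovariant.lie {n : ℕ} {C : Superop n} (hC : IsCovariant C) (K X : Op n) :
    C (K * X - X * K) = K * C X - C X * K := by
  let L : Superop n := C ∘ₗ (LinearMap.mulRight ℂ X - LinearMap.mulLeft ℂ X)
    - (LinearMap.mulRight ℂ (C X) - LinearMap.mulLeft ℂ (C X))
  have hL : ∀ K, L K = C (K * X - X * K) - (K * C X - C X * K) := fun K => by simp [L]
  have hproj : ∀ P : Op n, Pᴴ = P → P * P = P → L P = 0 := fun P h1 h2 => by
    rw [hL, hC.lie_of_projection P h1 h2, sub_self]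
  have hdiag : ∀ k, L (Matrix.single k k 1) = 0 := fun k => hproj _ (by simp) (by simp)
  have hoff : ∀ k l, k ≠ l → L (Matrix.single k l 1) = 0 := by
    intro k l hkl
    have h : ∀ s : ℂ, s * star s = 1 →
        L (Matrix.single k l s) + L (Matrix.single l k (star s)) = 0 := by
      intro s hs
      have hs' : star s * s = 1 := by rw [mul_comm, hs]
      have h1 := hproj ((1 / 2 : ℂ) • (Matrix.single k k 1 + Matrix.single l l 1
        + Matrix.single k l s + Matrix.single l k (star s))) (by
          simp only [conjTranspose_smul, conjTranspose_add, conjTranspose_single, star_one,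
            star_star]
          have : star (1 / 2 : ℂ) = 1 / 2 := by simp
          rw [this]
          abel_nf) (by
          rw [smul_mul_smul_comm]
          simp only [add_mul, mul_add, single_mul_single_same, mul_one, one_mul, hs, hs',
            single_mul_single_of_ne _ _ _ _ hkl, single_mul_single_of_ne _ _ _ _ hkl.symm]
          module)
      rw [map_smul, map_add, map_add, map_add, hdiag, hdiag, zero_add, zero_add] at h1
      exact (smul_eq_zero.mp h1).resolve_left (by norm_num)
    have h1 := h 1 (by simp)
    have h2 := h Complex.I (by simp)
    have h3 : ∀ (i j : Bits n) (s : ℂ), L (Matrix.single i j s) = s • L (Matrix.single i j 1) :=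
      fun i j s => by rw [← map_smul]; simp
    rw [h3 k l Complex.I, h3 l k] at h2
    rw [star_one] at h1
    have h4 : (2 : ℂ) • L (Matrix.single k l 1) = 0 := by
      have h5 : (2 : ℂ) • L (Matrix.single k l 1)
          = (L (Matrix.single k l 1) + L (Matrix.single l k 1))
            - Complex.I • (Complex.I • L (Matrix.single k l 1)
              + star Complex.I • L (Matrix.single l k 1)) := by
        simp only [smul_add, smul_smul, Complex.I_mul_I, Complex.star_def, Complex.conj_I, mul_neg]
        module
      rw [h5, h1, h2, smul_zero, sub_zero]
    exact (smul_eq_zero.mp h4).resolve_left (by norm_num)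
  have hall : L K = 0 := by
    rw [matrix_eq_sum_single K, map_sum]
    refine Finset.sum_eq_zero fun i _ => ?_
    rw [map_sum]
    refine Finset.sum_eq_zero fun j _ => ?_
    have : Matrix.single i j (K i j) = K i j • Matrix.single i j (1 : ℂ) := by simp
    rw [this, map_smul]
    rcases eq_or_ne i j with rfl | hij
    · rw [hdiag, smul_zero]
    · rw [hoff i j hij, smul_zero]
  rw [hL, sub_eq_zero] at hall
  exact hall

lemma single_mul_entry {ι : Type*} [Fintype ι] [DecidableEq ι] (A : Matrix ι ι ℂ) (i j k l : ι) :
    (Matrix.single i j 1 * A : Matrix ι ι ℂ) k l = if k = i then A j l else 0 := by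
  rcases eq_or_ne k i with rfl | h
  · simp
  · simp [h]

lemma mul_single_entry {ι : Type*} [Fintype ι] [DecidableEq ι] (A : Matrix ι ι ℂ) (i j k l : ι) :
    (A * Matrix.single i j 1 : Matrix ι ι ℂ) k l = if l = j then A k i else 0 := by
  rcases eq_or_ne l j with rfl | h
  · simp
  · simp [h]

/-- `C 1` commutes with every matrix unit, hence is scalar, and its trace vanishes. -/
lemma IsCovariant.apply_one {n : ℕ} {C : Superop n} (hC : IsCovariant C)
    (htr : ∀ X, (C X).trace = 0) : C 1 = 0 := by
  obtain ⟨z, hz⟩ := (mem_range_scalar_iff_commute_single' (M := C 1)).mpr fun i j => by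
    have h := hC.lie (Matrix.single i j 1) 1
    rw [Matrix.mul_one, Matrix.one_mul, sub_self, map_zero] at h
    exact sub_eq_zero.mp h.symm
  have h := htr 1
  rw [← hz] at h ⊢
  have : z = 0 := by simpa using h
  rw [this, map_zero]

/-- A weight argument: brackets with diagonal units confine `C (single i j 1)` to the line of
`single i j 1`, and brackets with off-diagonal units carry the scalar from one pair of indices to
another and to the diagonal differences. -/
lemma IsCovariant.exists_smul_single {n : ℕ} {C : Superop n} (hC : IsCovariant C) :
    ∃ c : ℂ, ∀ i j : Bits n, i ≠ j →
      C (Matrix.single i j 1) = c • Matrix.single i j 1 ∧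
      C (Matrix.single i i 1 - Matrix.single j j 1)
        = c • (Matrix.single i i 1 - Matrix.single j j 1) := by
  have hoff : ∀ i j : Bits n, i ≠ j →
      C (Matrix.single i j 1) = C (Matrix.single i j 1) i j • Matrix.single i j 1 := by
    intro i j hij
    have h1 := hC.lie (Matrix.single i i 1) (Matrix.single i j 1)
    have h2 := hC.lie (Matrix.single j j 1) (Matrix.single i j 1)
    rw [single_mul_single_same, single_mul_single_of_ne _ _ _ _ hij.symm, mul_one, sub_zero] at h1
    rw [single_mul_single_same, single_mul_single_of_ne _ _ _ _ hij.symm, mul_one, zero_sub,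
      map_neg] at h2
    ext k l
    have h1' := congrFun (congrFun h1 k) l
    have h2' := congrFun (congrFun h2 k) l
    rw [Matrix.sub_apply, single_mul_entry, mul_single_entry] at h1' h2'
    rw [Matrix.neg_apply] at h2'
    rw [Matrix.smul_apply, Matrix.single_apply]
    by_cases hk : k = i
    · subst hk
      by_cases hl : l = j
      · subst hl; simp
      · simpa [hij, hl, Ne.symm hl] using h2'
    · rw [if_neg hk] at h1'
      rw [if_neg (fun h => hk h.1.symm), smul_zero]
      by_cases hl : l = i
      · subst hl
        rw [if_pos rfl, zero_sub] at h1'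
        exact self_eq_neg.mp h1'
      · simpa [hl] using h1'
  have hdiag : ∀ i j : Bits n, i ≠ j → C (Matrix.single i i 1 - Matrix.single j j 1)
      = C (Matrix.single j i 1) j i • (Matrix.single i i 1 - Matrix.single j j 1) := by
    intro i j hij
    have h1 := hC.lie (Matrix.single i j 1) (Matrix.single j i 1)
    rw [hoff j i hij.symm, single_mul_single_same, single_mul_single_same, mul_one,
      Matrix.mul_smul, Matrix.smul_mul, single_mul_single_same, single_mul_single_same, mul_one,
      ← smul_sub] at h1
    exact h1
  have hsymm : ∀ i j : Bits n, i ≠ j → C (Matrix.single i j 1) i j = C (Matrix.single j i 1) j i := by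
    intro i j hij
    have h1 := hdiag i j hij
    have h2 := hdiag j i hij.symm
    rw [← neg_sub, map_neg, h1, ← smul_neg] at h2
    have h3 := congrFun (congrFun h2 i) i
    simpa [hij, hij.symm, Matrix.single_apply] using h3.symm
  have hcol : ∀ i k j : Bits n, i ≠ j → k ≠ j →
      C (Matrix.single k j 1) k j = C (Matrix.single i j 1) i j := by
    intro i k j hij hkj
    have h1 := hC.lie (Matrix.single k i 1) (Matrix.single i j 1)
    rw [single_mul_single_same, single_mul_single_of_ne _ _ _ _ hkj.symm, mul_one, sub_zero,
      hoff i j hij, Matrix.mul_smul, Matrix.smul_mul, single_mul_single_same,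
      single_mul_single_of_ne _ _ _ _ hkj.symm, mul_one, smul_zero, sub_zero] at h1
    simpa using congrFun (congrFun h1 k) j
  have hall : ∀ i j k l : Bits n, i ≠ j → k ≠ l →
      C (Matrix.single k l 1) k l = C (Matrix.single i j 1) i j := by
    intro i j k l hij hkl
    rcases eq_or_ne k j with rfl | hkj
    · rw [hsymm k l hkl, hcol i l k hij hkl.symm]
    · rw [hsymm k l hkl, hcol j l k hkj.symm hkl.symm, ← hsymm k j hkj, hcol i k j hij hkj]
  by_cases hex : ∃ i j : Bits n, i ≠ j
  · obtain ⟨i, j, hij⟩ := hex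
    refine ⟨C (Matrix.single i j 1) i j, fun k l hkl => ⟨?_, ?_⟩⟩
    · rw [← hall i j k l hij hkl]; exact hoff k l hkl
    · rw [← hall i j l k hij hkl.symm]; exact hdiag k l hkl
  · push Not at hex
    exact ⟨0, fun k l hkl => absurd (hex k l) hkl⟩

/-- The traceless matrices are irreducible: a covariant superoperator with traceless values and
vanishing trace is zero. -/
lemma IsCovariant.eq_zero {n : ℕ} [Nontrivial (Bits n)] {C : Superop n} (hC : IsCovariant C)
    (htr : ∀ X, (C X).trace = 0)
    (hst : ∑ i, ∑ j, C (Matrix.single i j 1) i j = 0) : C = 0 := by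
  obtain ⟨c, hc⟩ := hC.exists_smul_single
  have hone := hC.apply_one htr
  set d : ℂ := (Fintype.card (Bits n) : ℂ) with hd
  have hd0 : d ≠ 0 := Nat.cast_ne_zero.mpr Fintype.card_ne_zero
  have hdd : ∀ i : Bits n, d • Matrix.single i i (1 : ℂ)
      = 1 + ∑ j, (Matrix.single i i 1 - Matrix.single j j 1) := fun i => by
    rw [Finset.sum_sub_distrib, Matrix.sum_single_one, Finset.sum_const, Finset.card_univ,
      ← Nat.cast_smul_eq_nsmul ℂ]
    abel
  have hE : ∀ i j : Bits n, d • C (Matrix.single i j 1)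
      = c • (d • Matrix.single i j 1 - (Matrix.single i j (1 : ℂ)).trace • 1) := by
    intro i j
    rcases eq_or_ne i j with rfl | hij
    · have h : ∀ j, C (Matrix.single i i 1 - Matrix.single j j 1)
          = c • (Matrix.single i i 1 - Matrix.single j j 1) := fun j => by
        rcases eq_or_ne i j with rfl | hij
        · simp
        · exact (hc i j hij).2
      rw [← map_smul, hdd, map_add, hone, zero_add, map_sum, trace_single_eq_same]
      simp only [h]
      rw [← Finset.smul_sum, one_smul, add_sub_cancel_left]
    · rw [(hc i j hij).1, trace_single_eq_of_ne _ _ _ hij, zero_smul, sub_zero, smul_comm]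
  -- Up to the factor `d`, `C` is `c` times the centering projection, of trace `d ^ 2 - 1`. This is
  -- nonzero as `d > 1`, so vanishing trace forces `c = 0`.
  have hsum : c * (d * (d ^ 2 - 1)) = 0 := by
    have h1 : ∑ i, ∑ j, (d • C (Matrix.single i j 1)) i j = 0 := by
      simp only [Matrix.smul_apply, ← Finset.smul_sum, hst, smul_zero]
    rw [← h1]
    have h2 : ∀ i j : Bits n, (d • C (Matrix.single i j 1)) i j
        = c * (d - if i = j then 1 else 0) := fun i j => by
      rw [hE]
      rcases eq_or_ne i j with rfl | hij
      · simp
      · simp [hij, trace_single_eq_of_ne _ _ _ hij]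
    simp only [h2, ← Finset.mul_sum, Finset.sum_sub_distrib, Finset.sum_const, Finset.card_univ,
      nsmul_eq_mul, ← hd, Finset.sum_ite_eq, Finset.mem_univ, if_true]
    ring
  have hc0 : c = 0 := by
    refine (mul_eq_zero.mp hsum).resolve_right (mul_ne_zero hd0 ?_)
    have h1 : 1 < Fintype.card (Bits n) := Fintype.one_lt_card
    have h2 : (Fintype.card (Bits n)) ^ 2 ≠ 1 := by nlinarith
    rw [sub_ne_zero, hd]
    exact_mod_cast h2
  apply vec.injective
  ext q
  have h := hE q.2.1 q.2.2
  rw [hc0, zero_smul] at h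
  rw [vec_apply, (smul_eq_zero.mp h).resolve_left hd0]
  simp

/-! ### Averages of superoperators -/

lemma integral_linearMap {n : ℕ} {α : Type*} [MeasurableSpace α] {μ : Measure α} {f : α → HS n}
    (hf : Integrable f μ) (ℓ : HS n →ₗ[ℂ] ℂ) : ∫ a, ℓ (f a) ∂μ = ℓ (∫ a, f a ∂μ) :=
  (LinearMap.toContinuousLinearMap ℓ).integral_comp_comm hf

lemma continuous_vec {n : ℕ} {α : Type*} [TopologicalSpace α] {C : α → Superop n}
    (hC : ∀ X, Continuous fun t => C t X) : Continuous fun t => vec (C t) :=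
  (PiLp.continuous_toLp 2 _).comp (continuous_pi fun _ => (hC _).matrix_elem _ _)

lemma continuous_superop {n : ℕ} (C : Superop n) : Continuous C :=
  LinearMap.continuous_of_finiteDimensional C

lemma integrable_vec {n : ℕ} {μ : Measure (SU n)} [IsFiniteMeasure μ] {C : SU n → Superop n}
    (hC : ∀ X, Continuous fun t => C t X) : Integrable (fun g => vec (C g)) μ :=
  (continuous_vec hC).integrable_of_hasCompactSupport (HasCompactSupport.of_compactSpace _)

/-- Evaluation of a superoperator at a matrix, followed by a matrix entry. -/
def entry {n : ℕ} (X : Op n) (i j : Bits n) : HS n →ₗ[ℂ] ℂ where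
  toFun x := vec.symm x X i j
  map_add' x y := by simp
  map_smul' c x := by simp

lemma entry_apply {n : ℕ} (X : Op n) (i j : Bits n) (x : HS n) :
    entry X i j x = vec.symm x X i j := rfl

/-- One cycle of the averaged circuit, in the picture where superoperators evolve. -/
def cycle {n : ℕ} (φ : SU n → Superop n) (C : Superop n) (g : SU n) : Superop n :=
  omega g⁻¹ ∘ₗ C ∘ₗ φ g

/-- The average of a cycle over the gates. -/
def average {n : ℕ} (μ : Measure (SU n)) (φ : SU n → Superop n)
    (hI : ∀ C, Integrable (fun g => vec (cycle φ C g)) μ) : HS n →ₗ[ℂ] HS n where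
  toFun x := ∫ g, vec (cycle φ (vec.symm x) g) ∂μ
  map_add' x y := by
    rw [← integral_add (hI _) (hI _)]
    congr with g
    simp [cycle, LinearMap.add_comp, LinearMap.comp_add]
  map_smul' c x := by
    rw [RingHom.id_apply, ← integral_smul]
    congr with g
    simp [cycle, LinearMap.smul_comp, LinearMap.comp_smul]

lemma average_apply {n : ℕ} (μ : Measure (SU n)) (φ : SU n → Superop n)
    (hI : ∀ C, Integrable (fun g => vec (cycle φ C g)) μ) (x : HS n) :
    average μ φ hI x = ∫ g, vec (cycle φ (vec.symm x) g) ∂μ := rfl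

lemma continuous_omega_inv {n : ℕ} {X : SU n → Op n} (hX : Continuous X) :
    Continuous fun g : SU n => omega g⁻¹ (X g) :=
  continuous_omega_apply hX continuous_inv

lemma integrable_vec_cycle_omega {n : ℕ} (μ : Measure (SU n)) [IsFiniteMeasure μ] (C : Superop n) :
    Integrable (fun g => vec (cycle omega C g)) μ :=
  integrable_vec fun _ => continuous_omega_inv
    ((continuous_superop C).comp (continuous_omega_apply continuous_const continuous_id))

lemma vec_twirl {n : ℕ} (μ : Measure (SU n)) [IsFiniteMeasure μ] (C : Superop n) :
    vec (twirl μ C) = ∫ g, vec (cycle omega C g) ∂μ := by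
  ext q
  rw [eval_integral_piLp fun q => integrable_piLp_iff.mp (integrable_vec_cycle_omega μ C) q]
  rfl

lemma average_omega {n : ℕ} (μ : Measure (SU n)) [IsFiniteMeasure μ] (x : HS n) :
    average μ omega (integrable_vec_cycle_omega μ) x = vec (twirl μ (vec.symm x)) := by
  rw [vec_twirl, average_apply]

/-- A right translate of a left Haar probability measure is again one, so uniqueness applies. -/
instance (n : ℕ) : (haarSU n).IsMulRightInvariant := by
  have : (haarSU n).IsHaarMeasure := by unfold haarSU; infer_instance
  refine ⟨fun g => ?_⟩
  have : IsProbabilityMeasure ((haarSU n).map (· * g)) :=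
    Measure.isProbabilityMeasure_map (measurable_mul_const g).aemeasurable
  exact Measure.isHaarMeasure_eq_of_isProbabilityMeasure _ _

/-- Substituting `g ↦ g h⁻¹` in the integral moves `omega h` from the right of the integrand to its
left. -/
lemma isCovariant_twirl_haar {n : ℕ} (C : Superop n) : IsCovariant (twirl (haarSU n) C) := by
  intro h X
  ext i j
  have hI := integrable_vec_cycle_omega (haarSU n) C
  let ℓ : HS n →ₗ[ℂ] ℂ :=
    { toFun := fun x => omega h (vec.symm x X) i j
      map_add' := fun x y => by simp
      map_smul' := fun c x => by simp }
  have hℓ : ∀ D : Superop n, ℓ (vec D) = omega h (D X) i j := fun D => by simp [ℓ]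
  have h1 : omega h (twirl (haarSU n) C X) i j
      = ∫ g, omega h (cycle omega C g X) i j ∂(haarSU n) := by
    rw [← hℓ, vec_twirl, ← integral_linearMap hI]
    simp only [hℓ]
  have h2 : twirl (haarSU n) C (omega h X) i j
      = ∫ g, cycle omega C g (omega h X) i j ∂(haarSU n) := rfl
  rw [h1, h2, ← integral_mul_right_eq_self _ h⁻¹]
  congr with g
  have h3 : cycle omega C (g * h⁻¹) (omega h X) = omega h (cycle omega C g X) := by
    simp only [cycle, _root_.mul_inv_rev, inv_inv, LinearMap.comp_apply, omega_mul]
    have := congrArg (fun D : Superop n => D X) (omega_inv_comp h)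
    simp only [LinearMap.comp_apply, LinearMap.id_apply] at this
    rw [this]
  rw [h3]

/-! ### Mixtures of unitary channels -/

lemma continuous_omega_eval {n : ℕ} (X : Op n) : Continuous fun u : SU n => omega u X :=
  continuous_omega_apply continuous_const continuous_id

lemma integrable_vec_comp_omega {n : ℕ} (ν : Measure (SU n)) [IsFiniteMeasure ν] (D : Superop n) :
    Integrable (fun u => vec (D ∘ₗ omega u)) ν :=
  integrable_vec fun X => (continuous_superop D).comp (continuous_omega_eval X)

lemma IsUnitaryMixture.vec_eq {n : ℕ} {Φ : Superop n} {ν : Measure (SU n)}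
    (h : IsUnitaryMixture Φ ν) : vec Φ = ∫ u, vec (omega u) ∂ν := by
  have := h.isProbabilityMeasure
  ext q
  rw [eval_integral_piLp fun q => integrable_piLp_iff.mp
    (integrable_vec (μ := ν) continuous_omega_eval) q]
  exact h.eq_integral _ _ _

lemma IsUnitaryMixture.vec_comp_eq {n : ℕ} {Φ : Superop n} {ν : Measure (SU n)}
    (h : IsUnitaryMixture Φ ν) (D : Superop n) : vec (D ∘ₗ Φ) = ∫ u, vec (D ∘ₗ omega u) ∂ν := by
  have := h.isProbabilityMeasure
  let L : HS n →ₗ[ℂ] HS n :=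
    { toFun := fun x => vec (D ∘ₗ vec.symm x)
      map_add' := fun x y => by simp [LinearMap.comp_add]
      map_smul' := fun c x => by simp [LinearMap.comp_smul] }
  have hL : ∀ C, vec (D ∘ₗ C) = LinearMap.toContinuousLinearMap L (vec C) := fun C => by simp [L]
  simp only [hL]
  rw [h.vec_eq, ContinuousLinearMap.integral_comp_comm]
  exact integrable_vec continuous_omega_eval

/-- An average of isometries is a contraction. For a general channel this can fail. -/
lemma IsUnitaryMixture.hsNorm_comp_le {n : ℕ} {Φ : Superop n} {ν : Measure (SU n)}
    (h : IsUnitaryMixture Φ ν) (D : Superop n) : hsNorm (D ∘ₗ Φ) ≤ hsNorm D := by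
  have := h.isProbabilityMeasure
  rw [← norm_vec, h.vec_comp_eq]
  refine (norm_integral_le_of_norm_le_const (C := hsNorm D) ?_).trans (by simp)
  filter_upwards with u
  rw [norm_vec, hsNorm_comp_omega]

lemma IsUnitaryMixture.hsNorm_comp_sub_le {n : ℕ} {Φ : Superop n} {ν : Measure (SU n)}
    (h : IsUnitaryMixture Φ ν) (D : Superop n) (g : SU n) :
    hsNorm (D ∘ₗ Φ - D ∘ₗ omega g)
      ≤ (∫ u, diamondNorm (omega g - omega u) ∂ν) * hsNorm D := by
  have := h.isProbabilityMeasure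
  have h1 : vec (D ∘ₗ omega g) = ∫ u, vec (D ∘ₗ omega g) ∂ν := by simp
  rw [← norm_vec, map_sub, h.vec_comp_eq, h1,
    ← integral_sub (integrable_vec_comp_omega ν D) (integrable_const _), ← integral_mul_const]
  refine norm_integral_le_of_norm_le ((integrable_diamondNorm_omega_sub g ν).mul_const _) ?_
  filter_upwards with u
  rw [← map_sub, ← LinearMap.comp_sub, norm_vec]
  exact hsNorm_comp_omega_sub_le D g u

lemma omega_conjTranspose {n : ℕ} (g : SU n) (X : Op n) : omega g Xᴴ = (omega g X)ᴴ := by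
  simp [omega_apply, conjTranspose_mul, Matrix.mul_assoc]

lemma trace_omega {n : ℕ} (g : SU n) (X : Op n) : (omega g X).trace = X.trace := by
  rw [omega_apply, Matrix.trace_mul_cycle, coe_SU_conjTranspose_mul, Matrix.one_mul]

lemma IsUnitaryMixture.apply_conjTranspose {n : ℕ} {Φ : Superop n} {ν : Measure (SU n)}
    (h : IsUnitaryMixture Φ ν) (X : Op n) : Φ Xᴴ = (Φ X)ᴴ := by
  ext i j
  rw [h.eq_integral, conjTranspose_apply, h.eq_integral, Complex.star_def, ← integral_conj]
  congr with u
  rw [omega_conjTranspose]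
  rfl

/-! ### The averaged circuit -/

lemma aemeasurable_cycle_entry {n : ℕ} {μ : Measure (SU n)} {φ : SU n → Superop n}
    (hφ : ∀ (X : Op n) (i j : Bits n), AEMeasurable (fun g => φ g X i j) μ)
    (C : Superop n) (X : Op n) (i j : Bits n) :
    AEMeasurable (fun g => cycle φ C g X i j) μ := by
  have h1 : ∀ k l, AEMeasurable (fun g => C (φ g X) k l) μ := fun k l => by
    simp only [apply_eq_sum_vec C]
    exact Finset.aemeasurable_fun_sum _ fun a _ => Finset.aemeasurable_fun_sum _ fun b _ =>
      (hφ X a b).mul_const _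
  have h2 : ∀ k l, AEMeasurable (fun g : SU n => (g : Op n) k l) μ := fun k l =>
    (continuous_coe_SU.matrix_elem k l).measurable.aemeasurable
  have h3 : ∀ g : SU n, cycle φ C g X i j
      = ∑ k, (∑ l, star ((g : Op n) l i) * C (φ g X) l k) * (g : Op n) k j := fun g => by
    simp [cycle, omega_apply, SU.coe_inv, Matrix.mul_apply]
  simp only [h3]
  have h4 : ∀ k l, AEMeasurable (fun g : SU n => star ((g : Op n) k l)) μ := fun k l =>
    Complex.continuous_conj.measurable.comp_aemeasurable (h2 k l)
  have h5 : ∀ k l, AEMeasurable (fun g : SU n => star ((g : Op n) l i) * C (φ g X) l k) μ := fun k l =>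
    (h4 l i).mul (h1 l k)
  have h6 : ∀ k, AEMeasurable (fun g : SU n => ∑ l, star ((g : Op n) l i) * C (φ g X) l k) μ := fun k =>
    Finset.aemeasurable_fun_sum _ fun l _ => h5 k l
  exact Finset.aemeasurable_fun_sum _ fun k _ => (h6 k).mul (h2 k j)

lemma hsNorm_cycle_le {n : ℕ} {φ : SU n → Superop n} {ν : Measure (SU n)} {g : SU n}
    (h : IsUnitaryMixture (φ g) ν) (C : Superop n) : hsNorm (cycle φ C g) ≤ hsNorm C := by
  rw [cycle, hsNorm_omega_comp]
  exact h.hsNorm_comp_le C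

lemma integrable_vec_cycle {n : ℕ} {μ : Measure (SU n)} [IsFiniteMeasure μ]
    {φ : SU n → Superop n} {ν : SU n → Measure (SU n)}
    (hφ : ∀ (X : Op n) (i j : Bits n), AEMeasurable (fun g => φ g X i j) μ)
    (hν : ∀ᵐ g ∂μ, IsUnitaryMixture (φ g) (ν g)) (C : Superop n) :
    Integrable (fun g => vec (cycle φ C g)) μ := by
  rw [integrable_piLp_iff]
  intro q
  refine Integrable.of_bound
    (aemeasurable_cycle_entry hφ C _ _ _).aestronglyMeasurable (hsNorm C) ?_
  filter_upwards [hν] with g hg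
  refine (PiLp.norm_apply_le _ q).trans ?_
  rw [norm_vec]
  exact hsNorm_cycle_le hg C

/-- The amplitude of `0ⁿ` in the circuit with `m` cycles, as a functional of the superoperator
between the ideal and the noisy part. -/
def amplitude {n : ℕ} (φ : SU n → Superop n) (ρ : Op n) (m : ℕ) (g : Fin m → SU n) :
    HS n →ₗ[ℂ] ℂ where
  toFun x := omega (idealCircuit m g)⁻¹ (vec.symm x (noisyCircuit φ m g ρ))
    (zeroBits n) (zeroBits n)
  map_add' x y := by simp
  map_smul' c x := by simp

lemma amplitude_zero {n : ℕ} (φ : SU n → Superop n) (ρ : Op n) (g : Fin 0 → SU n) :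
    amplitude φ ρ 0 g = entry ρ (zeroBits n) (zeroBits n) := by
  ext x : 1
  change omega (1 : SU n)⁻¹ (vec.symm x ρ) _ _ = _
  rw [inv_one, omega_one]
  rfl

/-- The last gate is adjacent to the superoperator in the middle, so it is absorbed first. -/
lemma amplitude_succ {n : ℕ} (φ : SU n → Superop n) (ρ : Op n) (m : ℕ) (g : Fin (m + 1) → SU n)
    (x : HS n) : amplitude φ ρ (m + 1) g x
      = amplitude φ ρ m (fun i => g i.castSucc)
          (vec (cycle φ (vec.symm x) (g (Fin.last m)))) := by
  change omega (g (Fin.last m) * idealCircuit m fun i => g i.castSucc)⁻¹ _ _ _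
    = omega (idealCircuit m fun i => g i.castSucc)⁻¹ (vec.symm (vec _) _) _ _
  rw [_root_.mul_inv_rev, omega_mul, LinearEquiv.symm_apply_apply]
  rfl

lemma linearMap_eq_sum {n : ℕ} (ℓ : HS n →ₗ[ℂ] ℂ) (x : HS n) :
    ℓ x = ∑ q, x q * ℓ (EuclideanSpace.single q 1) := by
  conv_lhs => rw [← (EuclideanSpace.basisFun (Idx n) ℂ).sum_repr x]
  simp

/-- Expanding the absorbed superoperator in coordinates makes the integrand a finite sum of products
of a function of the last gate and one of the others; Fubini then uses independence. `x` varies in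
the induction because each step changes it. -/
lemma integral_amplitude {n : ℕ} {μ : Measure (SU n)} [IsProbabilityMeasure μ]
    {φ : SU n → Superop n} (hI : ∀ C, Integrable (fun g => vec (cycle φ C g)) μ) (ρ : Op n)
    (m : ℕ) (x : HS n) :
    Integrable (fun g : Fin m → SU n => amplitude φ ρ m g x) (Measure.pi fun _ => μ) ∧
      ∫ g : Fin m → SU n, amplitude φ ρ m g x ∂(Measure.pi fun _ => μ)
        = entry ρ (zeroBits n) (zeroBits n) ((average μ φ hI ^ m) x) := by
  induction m generalizing x with
  | zero => simp [amplitude_zero]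
  | succ m ih =>
    let F : SU n × (Fin m → SU n) → ℂ := fun t =>
      ∑ q, vec (cycle φ (vec.symm x) t.1) q * amplitude φ ρ m t.2 (EuclideanSpace.single q 1)
    have hcoord : ∀ q, Integrable (fun g => vec (cycle φ (vec.symm x) g) q) μ := fun q =>
      integrable_piLp_iff.mp (hI _) q
    have hmp := measurePreserving_piFinSuccAbove (fun _ : Fin (m + 1) => μ) (Fin.last m)
    have hF : (fun g : Fin (m + 1) → SU n => amplitude φ ρ (m + 1) g x)
        = F ∘ MeasurableEquiv.piFinSuccAbove (fun _ => SU n) (Fin.last m) := by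
      ext g
      rw [amplitude_succ, linearMap_eq_sum]
      have h1 : (fun i : Fin m => g i.castSucc) = fun j => g ((Fin.last m).succAbove j) := by
        rw [Fin.succAbove_last]
      rw [h1]
      rfl
    have hterm : ∀ q, Integrable (fun t : SU n × (Fin m → SU n) =>
        vec (cycle φ (vec.symm x) t.1) q * amplitude φ ρ m t.2 (EuclideanSpace.single q 1))
        (μ.prod (Measure.pi fun _ => μ)) := fun q =>
      Integrable.mul_prod (f := fun g => vec (cycle φ (vec.symm x) g) q)
        (g := fun g => amplitude φ ρ m g (EuclideanSpace.single q 1)) (hcoord q) (ih _).1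
    have hFint : Integrable F (μ.prod (Measure.pi fun _ => μ)) :=
      integrable_finsetSum _ fun q _ => hterm q
    constructor
    · rw [hF]
      exact (hmp.integrable_comp_emb (MeasurableEquiv.measurableEmbedding _)).mpr hFint
    · rw [hF]
      change ∫ g, F (MeasurableEquiv.piFinSuccAbove (fun _ => SU n) (Fin.last m) g) ∂_ = _
      rw [hmp.integral_comp' (g := F), integral_finsetSum _ fun q _ => hterm q, pow_succ,
        Module.End.mul_apply]
      have h2 := linearMap_eq_sum
        (entry ρ (zeroBits n) (zeroBits n) ∘ₗ (average μ φ hI ^ m)) (average μ φ hI x)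
      simp only [LinearMap.comp_apply] at h2
      rw [h2]
      have h3 : ∀ q, ∫ t : SU n × (Fin m → SU n), vec (cycle φ (vec.symm x) t.1) q
          * amplitude φ ρ m t.2 (EuclideanSpace.single q 1) ∂(μ.prod (Measure.pi fun _ => μ))
          = average μ φ hI x q * entry ρ (zeroBits n) (zeroBits n)
            ((average μ φ hI ^ m) (EuclideanSpace.single q 1)) := fun q => by
        rw [integral_prod_mul (fun g => vec (cycle φ (vec.symm x) g) q)
          (fun g => amplitude φ ρ m g (EuclideanSpace.single q 1)), (ih _).2, average_apply,
          eval_integral_piLp hcoord]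
      exact Finset.sum_congr rfl fun q _ => h3 q

/-- The measure-and-prepare channel of a measurement. -/
def measureChannel {n : ℕ} (M : Bits n → Op n) : Superop n where
  toFun X := Matrix.diagonal fun x => (M x * X).trace
  map_add' X Y := by
    ext i j
    rcases eq_or_ne i j with rfl | h
    · simp [Matrix.mul_add]
    · simp [h]
  map_smul' c X := by
    ext i j
    rcases eq_or_ne i j with rfl | h
    · simp
    · simp [h]

lemma measureChannel_apply {n : ℕ} (M : Bits n → Op n) (X : Op n) :
    measureChannel M X = Matrix.diagonal fun x => (M x * X).trace := rfl

namespace LinearXEB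

variable {n : ℕ} (E : LinearXEB n)

lemma amplitude_measureChannel_re {m : ℕ} (g : Fin m → SU n) :
    (amplitude E.φ E.ρ₀ m g (vec (measureChannel E.M))).re
      = ∑ x, idealProb g x * E.noisyProb g x := by
  have h : amplitude E.φ E.ρ₀ m g (vec (measureChannel E.M))
      = ∑ x, ((‖(idealCircuit m g : Op n) x (zeroBits n)‖ ^ 2 : ℝ) : ℂ)
          * (E.M x * noisyCircuit E.φ m g E.ρ₀).trace := by
    change omega (idealCircuit m g)⁻¹ (vec.symm (vec (measureChannel E.M)) _) _ _ = _
    rw [LinearEquiv.symm_apply_apply, measureChannel_apply, omega_apply, SU.coe_inv,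
      conjTranspose_conjTranspose, Matrix.mul_apply]
    refine Finset.sum_congr rfl fun x _ => ?_
    rw [Matrix.mul_diagonal, conjTranspose_apply, Complex.star_def, Complex.ofReal_pow,
      ← Complex.conj_mul']
    ring
  rw [h, Complex.re_sum]
  refine Finset.sum_congr rfl fun x _ => ?_
  rw [Complex.re_ofReal_mul]
  rfl

lemma qR_eq (hI : ∀ C, Integrable (fun g => vec (cycle E.φ C g)) E.μ) (m : ℕ) :
    E.qR m = -1 + 2 ^ n * (entry E.ρ₀ (zeroBits n) (zeroBits n)
      ((average E.μ E.φ hI ^ m) (vec (measureChannel E.M)))).re := by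
  obtain ⟨h1, h2⟩ := integral_amplitude hI E.ρ₀ m (vec (measureChannel E.M))
  rw [← h2, qR]
  congr 2
  have h3 := integral_re h1
  simp only [RCLike.re_to_complex] at h3
  rw [← h3]
  simp only [amplitude_measureChannel_re]

end LinearXEB

/-! ### Traceless Hermiticity-preserving superoperators -/

/-- The real space of Hermiticity-preserving superoperators with traceless values. -/
def tracelessHermitian (n : ℕ) : Submodule ℝ (HS n) where
  carrier := {x | (∀ X, (vec.symm x X).trace = 0) ∧ ∀ X, vec.symm x Xᴴ = (vec.symm x X)ᴴ}
  add_mem' {x y} hx hy := by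
    refine ⟨fun X => ?_, fun X => ?_⟩
    · simp [hx.1, hy.1]
    · simp [hx.2, hy.2]
  zero_mem' := by simp
  smul_mem' r x hx := by
    have h : r • x = (r : ℂ) • x := by ext q; simp
    rw [h]
    refine ⟨fun X => ?_, fun X => ?_⟩
    · rw [map_smul, LinearMap.smul_apply, Matrix.trace_smul, hx.1, smul_zero]
    · rw [map_smul, LinearMap.smul_apply, LinearMap.smul_apply, hx.2, conjTranspose_smul,
        Complex.star_def, Complex.conj_ofReal]

lemma vec_mem_tracelessHermitian {n : ℕ} {C : Superop n} : vec C ∈ tracelessHermitian n ↔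
    (∀ X, (C X).trace = 0) ∧ ∀ X, C Xᴴ = (C X)ᴴ := by
  change ((∀ X, (vec.symm (vec C) X).trace = 0) ∧ _) ↔ _
  rw [LinearEquiv.symm_apply_apply]

lemma vec_cycle_mem {n : ℕ} {φ : SU n → Superop n} {ν : Measure (SU n)} {g : SU n}
    (h : IsUnitaryMixture (φ g) ν) {C : Superop n} (hC : vec C ∈ tracelessHermitian n) :
    vec (cycle φ C g) ∈ tracelessHermitian n := by
  rw [vec_mem_tracelessHermitian] at hC ⊢
  refine ⟨fun X => ?_, fun X => ?_⟩
  · simp only [cycle, LinearMap.comp_apply, trace_omega, hC.1]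
  · simp only [cycle, LinearMap.comp_apply, h.apply_conjTranspose, hC.2, omega_conjTranspose]

lemma isUnitaryMixture_omega {n : ℕ} (g : SU n) :
    IsUnitaryMixture (omega g) (Measure.dirac g) :=
  ⟨inferInstance, fun X i j => (integral_dirac' (fun u : SU n => omega u X i j) g
    ((continuous_omega_eval X).matrix_elem i j).stronglyMeasurable).symm⟩

lemma average_mem {n : ℕ} {μ : Measure (SU n)} [IsProbabilityMeasure μ] {φ : SU n → Superop n}
    {ν : SU n → Measure (SU n)} (hν : ∀ᵐ g ∂μ, IsUnitaryMixture (φ g) (ν g))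
    (hI : ∀ C, Integrable (fun g => vec (cycle φ C g)) μ) {x : HS n}
    (hx : x ∈ tracelessHermitian n) : average μ φ hI x ∈ tracelessHermitian n := by
  refine (tracelessHermitian n).convex.integral_mem
    (tracelessHermitian n).closed_of_finiteDimensional ?_ (hI _)
  filter_upwards [hν] with g hg
  refine vec_cycle_mem hg ?_
  rwa [LinearEquiv.apply_symm_apply]

/-- The trace of a superoperator. -/
def superTrace (n : ℕ) : HS n →ₗ[ℂ] ℂ where
  toFun x := ∑ p, x (p, p)
  map_add' x y := by simp [Finset.sum_add_distrib]
  map_smul' c x := by simp [Finset.mul_sum]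

lemma superTrace_vec {n : ℕ} (C : Superop n) : superTrace n (vec C) = (liou C).trace := rfl

lemma superTrace_cycle_omega {n : ℕ} (C : Superop n) (g : SU n) :
    superTrace n (vec (cycle omega C g)) = superTrace n (vec C) := by
  rw [superTrace_vec, superTrace_vec, cycle, liou_comp, liou_comp, Matrix.trace_mul_comm,
    Matrix.mul_assoc, ← liou_comp, omega_comp_inv, liou_id, Matrix.mul_one]

lemma superTrace_twirl {n : ℕ} (μ : Measure (SU n)) [IsProbabilityMeasure μ] (C : Superop n) :
    superTrace n (vec (twirl μ C)) = superTrace n (vec C) := by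
  rw [vec_twirl, ← integral_linearMap (integrable_vec_cycle_omega μ C)]
  simp [superTrace_cycle_omega]

/-- Conjugation exchanges the diagonal coefficients at `(i, j)` and `(j, i)`. Thus real
orthogonality to `centering n` kills the whole complex trace. -/
lemma superTrace_im {n : ℕ} {C : Superop n} (hC : vec C ∈ tracelessHermitian n) :
    (superTrace n (vec C)).im = 0 := by
  rw [← Complex.conj_eq_iff_im]
  change (starRingEnd ℂ) (∑ p, vec C (p, p)) = ∑ p, vec C (p, p)
  rw [map_sum, Fintype.sum_prod_type, Fintype.sum_prod_type, Finset.sum_comm]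
  refine Finset.sum_congr rfl fun i _ => Finset.sum_congr rfl fun j _ => ?_
  have h := congrFun (congrFun ((vec_mem_tracelessHermitian.mp hC).2 (Matrix.single j i 1)) i) j
  rw [conjTranspose_single, star_one, conjTranspose_apply] at h
  simp only [vec_apply]
  rw [h]
  rfl

/-- The completely depolarizing channel. -/
def depolarizing (n : ℕ) : Superop n where
  toFun X := (((2 : ℂ) ^ n)⁻¹ * X.trace) • 1
  map_add' X Y := by simp [mul_add, add_smul]
  map_smul' c X := by simp [smul_smul, mul_left_comm]

lemma depolarizing_apply {n : ℕ} (X : Op n) :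
    depolarizing n X = (((2 : ℂ) ^ n)⁻¹ * X.trace) • 1 := rfl

/-- The projection onto the traceless matrices. -/
def centering (n : ℕ) : Superop n := LinearMap.id - depolarizing n

lemma card_bits (n : ℕ) : (Fintype.card (Bits n) : ℂ) = 2 ^ n := by simp

lemma trace_depolarizing {n : ℕ} (X : Op n) : (depolarizing n X).trace = X.trace := by
  rw [depolarizing_apply, Matrix.trace_smul, Matrix.trace_one, card_bits, smul_eq_mul]
  field_simp

lemma depolarizing_conjTranspose {n : ℕ} (X : Op n) :
    depolarizing n Xᴴ = (depolarizing n X)ᴴ := by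
  simp [depolarizing_apply, conjTranspose_smul, trace_conjTranspose]

lemma centering_mem (n : ℕ) : vec (centering n) ∈ tracelessHermitian n := by
  rw [vec_mem_tracelessHermitian]
  refine ⟨fun X => ?_, fun X => ?_⟩
  · simp [centering, trace_depolarizing]
  · simp [centering, depolarizing_conjTranspose]

lemma omega_apply_one {n : ℕ} (g : SU n) : omega g 1 = 1 := by
  rw [omega_apply, Matrix.mul_one]
  exact mul_eq_one_comm.mp (coe_SU_conjTranspose_mul g)

lemma cycle_depolarizing {n : ℕ} {φ : SU n → Superop n} {g : SU n}
    (h : ∀ X, (φ g X).trace = X.trace) : cycle φ (depolarizing n) g = depolarizing n := by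
  ext X : 1
  simp only [cycle, LinearMap.comp_apply, depolarizing_apply, map_smul, omega_apply_one, h]

lemma cycle_omega_centering {n : ℕ} (g : SU n) : cycle omega (centering n) g = centering n := by
  have h := cycle_depolarizing (trace_omega g)
  rw [cycle] at h
  rw [cycle, centering, LinearMap.sub_comp, LinearMap.comp_sub, h, LinearMap.id_comp,
    omega_inv_comp]

/-- The identity contributes the trace of `C`; the depolarizing part only sees traces of values of
`C`, which vanish. -/
lemma inner_centering {n : ℕ} {C : Superop n} (hC : ∀ X, (C X).trace = 0) :
    inner ℝ (vec (centering n)) (vec C) = (superTrace n (vec C)).re := by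
  rw [PiLp.inner_apply]
  simp only [Complex.inner]
  rw [← Complex.re_sum]
  congr 1
  have h1 : ∀ q : Idx n, vec C q * (starRingEnd ℂ) (vec (centering n) q)
      = (if q.2 = q.1 then vec C q else 0)
        - ((2 : ℂ) ^ n)⁻¹ * (if q.2.1 = q.2.2 then (if q.1.1 = q.1.2 then vec C q else 0) else 0) := by
    intro q
    obtain ⟨⟨k, l⟩, ⟨i, j⟩⟩ := q
    have h2 : vec (centering n) ((k, l), (i, j))
        = (if i = k ∧ j = l then 1 else 0)
          - ((2 : ℂ) ^ n)⁻¹ * ((if i = j then 1 else 0) * if k = l then 1 else 0) := by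
      rw [vec_apply, centering, LinearMap.sub_apply, LinearMap.id_apply, depolarizing_apply,
        Matrix.sub_apply, Matrix.single_apply, Matrix.smul_apply, Matrix.one_apply, smul_eq_mul,
        mul_assoc]
      rcases eq_or_ne i j with rfl | hij
      · simp
      · simp [hij, trace_single_eq_of_ne _ _ _ hij]
    rw [h2]
    simp only [Prod.ext_iff, map_sub, map_mul, map_inv₀, map_pow, mul_sub]
    congr 1
    · split_ifs <;> simp
    · have : (starRingEnd ℂ) 2 = 2 := Complex.conj_ofNat 2
      rw [this]
      split_ifs <;> simp [mul_comm]
  simp only [h1, Finset.sum_sub_distrib, ← Finset.mul_sum]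
  have h3 : ∑ q : Idx n,
      (if q.2.1 = q.2.2 then (if q.1.1 = q.1.2 then vec C q else 0) else 0) = 0 := by
    rw [Fintype.sum_prod_type_right]
    refine Finset.sum_eq_zero fun p _ => ?_
    obtain ⟨i, j⟩ := p
    by_cases hij : i = j
    · simp only [hij, if_true, Fintype.sum_prod_type, Finset.sum_ite_eq, Finset.mem_univ]
      exact hC (Matrix.single j j 1)
    · simp [hij]
  rw [h3, mul_zero, sub_zero, Fintype.sum_prod_type]
  simp only [Finset.sum_ite_eq', Finset.mem_univ, if_true]
  rfl

lemma superTrace_centering (n : ℕ) : superTrace n (vec (centering n)) = (2 ^ n) ^ 2 - 1 := by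
  change ∑ p : Bits n × Bits n, vec (centering n) (p, p) = _
  have h : ∀ p : Bits n × Bits n, vec (centering n) (p, p)
      = 1 - ((2 : ℂ) ^ n)⁻¹ * if p.1 = p.2 then 1 else 0 := fun p => by
    obtain ⟨i, j⟩ := p
    rw [vec_apply, centering, LinearMap.sub_apply, LinearMap.id_apply, depolarizing_apply,
      Matrix.sub_apply, Matrix.smul_apply, Matrix.one_apply]
    rcases eq_or_ne i j with rfl | hij
    · simp
    · simp [hij]
  simp only [h, Finset.sum_sub_distrib, ← Finset.mul_sum, Fintype.sum_prod_type,
    Finset.sum_ite_eq, Finset.mem_univ, if_true, Finset.sum_const, Finset.card_univ,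
    nsmul_eq_mul, card_bits, Fintype.card_prod, Nat.cast_mul]
  field_simp

lemma vec_centering_ne_zero (n : ℕ) [Nontrivial (Bits n)] : vec (centering n) ≠ 0 := by
  intro h0
  have h1 := superTrace_centering n
  rw [h0, map_zero, ← card_bits] at h1
  have h2 : 1 < Fintype.card (Bits n) := Fintype.one_lt_card
  have h3 : Fintype.card (Bits n) ^ 2 ≠ 1 := by nlinarith
  apply h3
  have h4 := (sub_eq_zero.mp h1.symm)
  exact_mod_cast h4

/-- The Haar twirl is covariant and inherits traceless values and vanishing trace, so irreducibility
applies. -/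
lemma twirl_haar_eq_zero {n : ℕ} [Nontrivial (Bits n)] {C : Superop n}
    (hC : vec C ∈ tracelessHermitian n) (h0 : inner ℝ (vec (centering n)) (vec C) = (0 : ℝ)) :
    twirl (haarSU n) C = 0 := by
  have htr : superTrace n (vec C) = 0 := by
    rw [inner_centering (vec_mem_tracelessHermitian.mp hC).1] at h0
    exact Complex.ext h0 (superTrace_im hC)
  refine (isCovariant_twirl_haar C).eq_zero ?_ ?_
  · have h1 := average_mem (Filter.Eventually.of_forall isUnitaryMixture_omega)
      (integrable_vec_cycle_omega (haarSU n)) hC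
    rw [average_omega, LinearEquiv.symm_apply_apply] at h1
    exact (vec_mem_tracelessHermitian.mp h1).1
  · have h2 := superTrace_twirl (haarSU n) C
    rw [htr] at h2
    rw [← Fintype.sum_prod_type']
    exact h2

lemma hsNorm_le_spectralNorm {n : ℕ} (L : Superop n →ₗ[ℂ] Superop n) (C : Superop n) :
    hsNorm (L C) ≤ spectralNorm L * hsNorm C := by
  let A : HS n →L[ℂ] HS n := LinearMap.toContinuousLinearMap
    (vec.toLinearMap ∘ₗ L ∘ₗ vec.symm.toLinearMap)
  have hA : ∀ C, A (vec C) = vec (L C) := fun C => by simp [A]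
  have hbdd : BddAbove {r : ℝ | ∃ C : Superop n, hsNorm C ≤ 1 ∧ r = hsNorm (L C)} := by
    refine ⟨‖A‖, ?_⟩
    rintro r ⟨D, hD, rfl⟩
    rw [← norm_vec, ← hA]
    refine (A.le_opNorm _).trans ?_
    rw [norm_vec]
    exact mul_le_of_le_one_right (norm_nonneg _) hD
  rcases (hsNorm_nonneg C).eq_or_lt with h0 | h0
  · have : vec C = 0 := by rw [← norm_eq_zero, norm_vec, ← h0]
    rw [← h0, mul_zero, ← norm_vec, ← hA, this, map_zero, norm_zero]
  · let t : ℂ := ((hsNorm C)⁻¹ : ℝ)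
    have ht : ∀ D : Superop n, hsNorm (t • D) = (hsNorm C)⁻¹ * hsNorm D := fun D => by
      rw [← norm_vec, map_smul, norm_smul, norm_vec, Complex.norm_real,
        Real.norm_of_nonneg (inv_nonneg.mpr h0.le)]
    have h1 : hsNorm (L (t • C)) ≤ spectralNorm L :=
      le_csSup hbdd ⟨t • C, by rw [ht, inv_mul_cancel₀ h0.ne'], rfl⟩
    rw [map_smul, ht, inv_mul_le_iff₀ h0] at h1
    linarith

lemma spectralNorm_nonneg {n : ℕ} (L : Superop n →ₗ[ℂ] Superop n) : 0 ≤ spectralNorm L := by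
  refine Real.sSup_nonneg ?_
  rintro r ⟨C, -, rfl⟩
  exact hsNorm_nonneg _

/-! ### Sizes of states and measurements -/

/-- Nonnegativity of a 2 × 2 principal minor. -/
lemma norm_sq_apply_le_of_posSemidef {ι : Type*} [Fintype ι] [DecidableEq ι]
    {A : Matrix ι ι ℂ} (hA : A.PosSemidef) (i j : ι) :
    ‖A i j‖ ^ 2 ≤ (A i i).re * (A j j).re := by
  have h := (hA.submatrix ![i, j]).det_nonneg
  rw [det_fin_two] at h
  simp only [submatrix_apply, cons_val_zero, cons_val_one] at h
  have h1 : A j i = star (A i j) := (hA.isHermitian.apply j i).symm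
  have hi : (A i i).im = 0 := ((Complex.nonneg_iff.mp (hA.diag_nonneg (i := i))).2).symm
  have h2 := (Complex.nonneg_iff.mp h).1
  rw [h1, Complex.star_def, Complex.mul_conj, Complex.sub_re, Complex.mul_re, hi,
    Complex.ofReal_re, Complex.normSq_eq_norm_sq] at h2
  linarith

lemma IsState.sum_norm_sq_le {n : ℕ} {ρ : Op n} (hρ : IsState ρ) :
    ∑ i, ∑ j, ‖ρ i j‖ ^ 2 ≤ 1 := by
  have h : ∑ i, (ρ i i).re = 1 := by
    have := congrArg Complex.re hρ.trace_eq_one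
    simpa [Matrix.trace] using this
  calc ∑ i, ∑ j, ‖ρ i j‖ ^ 2 ≤ ∑ i, ∑ j, (ρ i i).re * (ρ j j).re :=
        Finset.sum_le_sum fun i _ => Finset.sum_le_sum fun j _ =>
          norm_sq_apply_le_of_posSemidef hρ.posSemidef i j
    _ = 1 := by rw [← Finset.sum_mul_sum, h, one_mul]

/-- Cauchy-Schwarz against `ρ`, whose Hilbert-Schmidt norm is at most `1`. -/
lemma IsState.norm_entry_le {n : ℕ} {ρ : Op n} (hρ : IsState ρ) (k l : Bits n) (x : HS n) :
    ‖entry ρ k l x‖ ≤ ‖x‖ := by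
  have h1 : entry ρ k l x = ∑ p : Bits n × Bits n, ρ p.1 p.2 * x ((k, l), p) := by
    rw [entry_apply, apply_eq_sum_vec, LinearEquiv.apply_symm_apply, Fintype.sum_prod_type]
  have h2 : ∑ p : Bits n × Bits n, ‖x ((k, l), p)‖ ^ 2 ≤ ‖x‖ ^ 2 := by
    rw [EuclideanSpace.norm_sq_eq, Fintype.sum_prod_type (fun q : Idx n => ‖x q‖ ^ 2)]
    exact Finset.single_le_sum (f := fun q => ∑ p, ‖x (q, p)‖ ^ 2)
      (fun _ _ => Finset.sum_nonneg fun _ _ => by positivity) (Finset.mem_univ (k, l))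
  have h3 : ∑ p : Bits n × Bits n, ‖ρ p.1 p.2‖ ^ 2 ≤ 1 := by
    rw [Fintype.sum_prod_type]
    exact hρ.sum_norm_sq_le
  have h4 : ‖entry ρ k l x‖ ≤ ∑ p : Bits n × Bits n, ‖ρ p.1 p.2‖ * ‖x ((k, l), p)‖ := by
    rw [h1]
    exact (norm_sum_le _ _).trans (le_of_eq (by simp only [norm_mul]))
  refine h4.trans (abs_le_of_sq_le_sq' ?_ (norm_nonneg x)).2
  refine (Finset.sum_mul_sq_le_sq_mul_sq _ _ _).trans ?_
  calc _ ≤ 1 * ‖x‖ ^ 2 := mul_le_mul h3 h2 (Finset.sum_nonneg fun _ _ => by positivity) zero_le_one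
    _ = _ := one_mul _

lemma IsPOVM.norm_apply_le_one {n : ℕ} {M : Bits n → Op n} (hM : IsPOVM M) (x i j : Bits n) :
    ‖M x i j‖ ≤ 1 := by
  have h0 : ∀ y i, 0 ≤ (M y i i).re := fun y i =>
    (Complex.nonneg_iff.mp ((hM.posSemidef y).diag_nonneg (i := i))).1
  have h1 : ∀ i, (M x i i).re ≤ 1 := fun i => by
    have h := congrArg (fun A : Op n => (A i i).re) hM.sum_eq_one
    simp only [Matrix.sum_apply, Complex.re_sum, Matrix.one_apply_eq, Complex.one_re] at h
    rw [← h]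
    exact Finset.single_le_sum (f := fun y => (M y i i).re) (fun y _ => h0 y i) (Finset.mem_univ x)
  have h2 := norm_sq_apply_le_of_posSemidef (hM.posSemidef x) i j
  have h3 : ‖M x i j‖ ^ 2 ≤ 1 := h2.trans (mul_le_one₀ (h1 i) (h0 x j) (h1 j))
  exact (sq_le_one_iff₀ (norm_nonneg _)).mp h3

/-- The measurement with its completely depolarized part removed. -/
def centeredMeasurement {n : ℕ} (M : Bits n → Op n) : Superop n :=
  measureChannel M - depolarizing n

lemma IsPOVM.centeredMeasurement_mem {n : ℕ} {M : Bits n → Op n} (hM : IsPOVM M) :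
    vec (centeredMeasurement M) ∈ tracelessHermitian n := by
  rw [vec_mem_tracelessHermitian]
  refine ⟨fun X => ?_, fun X => ?_⟩
  · rw [centeredMeasurement, LinearMap.sub_apply, Matrix.trace_sub, trace_depolarizing,
      measureChannel_apply, Matrix.trace_diagonal, ← Matrix.trace_sum, ← Matrix.sum_mul,
      hM.sum_eq_one, Matrix.one_mul, sub_self]
  · rw [centeredMeasurement, LinearMap.sub_apply, LinearMap.sub_apply, conjTranspose_sub,
      depolarizing_conjTranspose, measureChannel_apply, measureChannel_apply,
      diagonal_conjTranspose]
    congr 2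
    ext x
    rw [Pi.star_apply, ← trace_conjTranspose, conjTranspose_mul, (hM.posSemidef x).isHermitian.eq,
      Matrix.trace_mul_comm]

/-- Values are diagonal, leaving at most `(2 ^ n) ^ 3` nonzero coefficients, each of modulus at most
`2`. -/
lemma IsPOVM.norm_sq_centeredMeasurement_le {n : ℕ} {M : Bits n → Op n} (hM : IsPOVM M) :
    ‖vec (centeredMeasurement M)‖ ^ 2 ≤ 4 * ((2 : ℝ) ^ n) ^ 3 := by
  have h1 : ∀ k l i j : Bits n, ‖vec (centeredMeasurement M) ((k, l), (i, j))‖ ^ 2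
      ≤ if k = l then 4 else 0 := by
    intro k l i j
    have h2 : vec (centeredMeasurement M) ((k, l), (i, j))
        = if k = l then M k j i - ((2 : ℂ) ^ n)⁻¹ * (Matrix.single i j (1 : ℂ)).trace else 0 := by
      rw [vec_apply, centeredMeasurement, LinearMap.sub_apply, Matrix.sub_apply,
        measureChannel_apply, depolarizing_apply, Matrix.smul_apply, Matrix.one_apply]
      rcases eq_or_ne k l with rfl | hkl
      · simp [Matrix.trace_mul_single]
      · simp [hkl]
    rw [h2]
    split_ifs
    · have h3 : ‖((2 : ℂ) ^ n)⁻¹ * (Matrix.single i j (1 : ℂ)).trace‖ ≤ 1 := by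
        have h4 : ‖((2 : ℂ) ^ n)⁻¹‖ ≤ 1 := by
          rw [norm_inv, norm_pow, Complex.norm_ofNat]
          exact inv_le_one_of_one_le₀ (one_le_pow₀ (by norm_num))
        rcases eq_or_ne i j with rfl | hij
        · simpa using h4
        · simp [trace_single_eq_of_ne _ _ _ hij]
      have h5 := norm_sub_le (M k j i) (((2 : ℂ) ^ n)⁻¹ * (Matrix.single i j (1 : ℂ)).trace)
      have h6 := hM.norm_apply_le_one k j i
      nlinarith [norm_nonneg (M k j i - ((2 : ℂ) ^ n)⁻¹ * (Matrix.single i j (1 : ℂ)).trace)]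
    · simp
  rw [EuclideanSpace.norm_sq_eq]
  simp only [Fintype.sum_prod_type]
  calc _ ≤ ∑ k : Bits n, ∑ l : Bits n, ∑ i : Bits n, ∑ j : Bits n, (if k = l then (4 : ℝ) else 0) :=
        Finset.sum_le_sum fun k _ => Finset.sum_le_sum fun l _ => Finset.sum_le_sum fun i _ =>
          Finset.sum_le_sum fun j _ => h1 k l i j
    _ = _ := by
        simp
        ring

/-! ### The decay of the linear XEB value -/

lemma norm_average_le {n : ℕ} {μ : Measure (SU n)} [IsProbabilityMeasure μ]
    {φ : SU n → Superop n} {ν : SU n → Measure (SU n)}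
    (hν : ∀ᵐ g ∂μ, IsUnitaryMixture (φ g) (ν g))
    (hI : ∀ C, Integrable (fun g => vec (cycle φ C g)) μ) (x : HS n) :
    ‖average μ φ hI x‖ ≤ ‖x‖ := by
  refine (norm_integral_le_of_norm_le_const (C := ‖x‖) ?_).trans (by simp)
  filter_upwards [hν] with g hg
  rw [norm_vec]
  refine (hsNorm_cycle_le hg _).trans (le_of_eq ?_)
  rw [← norm_vec, LinearEquiv.apply_symm_apply]

lemma norm_average_sub_le {n : ℕ} {μ : Measure (SU n)} [IsProbabilityMeasure μ]
    {φ : SU n → Superop n} {ν : SU n → Measure (SU n)}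
    (hν : ∀ᵐ g ∂μ, IsUnitaryMixture (φ g) (ν g))
    (hI : ∀ C, Integrable (fun g => vec (cycle φ C g)) μ)
    (hint : Integrable (fun g => ∫ u, diamondNorm (omega g - omega u) ∂(ν g)) μ) (x : HS n) :
    ‖average μ φ hI x - average μ omega (integrable_vec_cycle_omega μ) x‖
      ≤ (∫ g, ∫ u, diamondNorm (omega g - omega u) ∂(ν g) ∂μ) * ‖x‖ := by
  rw [average_apply, average_apply, ← integral_sub (hI _) (integrable_vec_cycle_omega μ _),
    ← integral_mul_const]
  refine norm_integral_le_of_norm_le (hint.mul_const _) ?_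
  filter_upwards [hν] with g hg
  rw [← map_sub, norm_vec, cycle, cycle, ← LinearMap.comp_sub, hsNorm_omega_comp]
  refine (hg.hsNorm_comp_sub_le _ g).trans (le_of_eq ?_)
  rw [← norm_vec (vec.symm x), LinearEquiv.apply_symm_apply]

lemma average_omega_centering {n : ℕ} (μ : Measure (SU n)) [IsProbabilityMeasure μ] :
    average μ omega (integrable_vec_cycle_omega μ) (vec (centering n)) = vec (centering n) := by
  rw [average_apply, LinearEquiv.symm_apply_apply]
  simp [cycle_omega_centering]

lemma inner_centering_average_omega {n : ℕ} (μ : Measure (SU n)) [IsProbabilityMeasure μ]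
    {x : HS n} (hx : x ∈ tracelessHermitian n) :
    inner ℝ (vec (centering n)) (average μ omega (integrable_vec_cycle_omega μ) x)
      = (inner ℝ (vec (centering n)) x : ℝ) := by
  have h := average_mem (Filter.Eventually.of_forall isUnitaryMixture_omega)
    (integrable_vec_cycle_omega μ) hx
  rw [average_omega] at h ⊢
  rw [inner_centering (vec_mem_tracelessHermitian.mp h).1, superTrace_twirl]
  rw [← LinearEquiv.apply_symm_apply vec x] at hx
  rw [← inner_centering (vec_mem_tracelessHermitian.mp hx).1, LinearEquiv.apply_symm_apply]

lemma norm_average_omega_le {n : ℕ} [Nontrivial (Bits n)] {μ : Measure (SU n)}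
    [IsProbabilityMeasure μ] {γ : ℝ} (hγ : IsApproxTwirlSpectral μ γ) {x : HS n}
    (hx : x ∈ tracelessHermitian n) (h0 : inner ℝ (vec (centering n)) x = (0 : ℝ)) :
    ‖average μ omega (integrable_vec_cycle_omega μ) x‖ ≤ γ * ‖x‖ := by
  rw [← LinearEquiv.apply_symm_apply vec x] at hx h0 ⊢
  have h1 := twirl_haar_eq_zero hx h0
  have h2 := hsNorm_le_spectralNorm (twirl μ - twirl (haarSU n)) (vec.symm x)
  rw [LinearMap.sub_apply, h1, sub_zero] at h2
  rw [average_omega, LinearEquiv.symm_apply_apply, norm_vec, norm_vec]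
  exact h2.trans (mul_le_mul_of_nonneg_right hγ (hsNorm_nonneg _))

/-- On the traceless Hermiticity-preserving maps, powers of the averaged noisy cycle follow a single
exponential. -/
lemma exists_average_pow_approx {n : ℕ} [Nontrivial (Bits n)] {μ : Measure (SU n)}
    [IsProbabilityMeasure μ] {φ : SU n → Superop n} {ν : SU n → Measure (SU n)} {γ δ : ℝ}
    (hγ : IsApproxTwirlSpectral μ γ) (hν : ∀ᵐ g ∂μ, IsUnitaryMixture (φ g) (ν g))
    (hI : ∀ C, Integrable (fun g => vec (cycle φ C g)) μ)
    (hint : Integrable (fun g => ∫ u, diamondNorm (omega g - omega u) ∂(ν g)) μ)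
    (hδ : ∫ g, ∫ u, diamondNorm (omega g - omega u) ∂(ν g) ∂μ ≤ δ) (hγ0 : 0 ≤ γ) (hδ0 : 0 ≤ δ)
    (hδγ : 11 * δ ≤ 1 - γ) :
    ∃ p ∈ Set.Icc (1 - 2 * δ) 1, ∀ x ∈ tracelessHermitian n, ∃ y : HS n, ∀ m : ℕ,
      ‖(average μ φ hI ^ m) x - p ^ m • y‖ ≤ 3 * (γ + 6 * δ) ^ m * ‖x‖ := by
  rcases lt_or_ge γ 1 with hγ1 | hγ1
  · have hpow : ∀ (m : ℕ) x, ((average μ φ hI).restrictScalars ℝ ^ m) x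
        = (average μ φ hI ^ m) x := fun m x => by
      induction m with
      | zero => rfl
      | succ m ih => rw [pow_succ', pow_succ', Module.End.mul_apply, Module.End.mul_apply, ih]; rfl
    have h := exists_dominant_eigenvalue_of_invariant (tracelessHermitian n)
      ((average μ φ hI).restrictScalars ℝ)
      ((average μ omega (integrable_vec_cycle_omega μ)).restrictScalars ℝ)
      (fun x hx => average_mem hν hI hx)
      (fun x hx => average_mem (Filter.Eventually.of_forall isUnitaryMixture_omega)
        (integrable_vec_cycle_omega μ) hx)
      (vec (centering n)) (centering_mem n) (vec_centering_ne_zero n) γ δ hγ0 hγ1 hδ0 hδγ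
      (average_omega_centering μ) (fun x hx => inner_centering_average_omega μ hx)
      (fun x hx h0 => norm_average_omega_le hγ hx h0)
      (fun x _ => norm_average_le hν hI x)
      (fun x _ => (norm_average_sub_le hν hI hint x).trans
        (mul_le_mul_of_nonneg_right hδ (norm_nonneg _)))
    simpa only [hpow] using h
  -- Here the hypotheses force `γ = 1` and `δ = 0`, and contractivity suffices with `y = 0`.
  · refine ⟨1, ⟨by linarith, le_rfl⟩, fun x hx => ⟨0, fun m => ?_⟩⟩
    have h1 : ‖(average μ φ hI ^ m) x‖ ≤ ‖x‖ := by
      induction m with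
      | zero => exact le_rfl
      | succ m ih =>
        rw [pow_succ', Module.End.mul_apply]
        exact (norm_average_le hν hI _).trans ih
    have h2 : 1 ≤ (γ + 6 * δ) ^ m := one_le_pow₀ (by linarith)
    rw [smul_zero, sub_zero]
    nlinarith [norm_nonneg x]

/-- The depolarizing channel is fixed by each cycle, since `φ g` preserves traces and `omega g` is
unital. Its entry `(2 ^ n)⁻¹` cancels the `-1`. -/
lemma LinearXEB.qR_eq_centered {n : ℕ} (E : LinearXEB n)
    (hI : ∀ C, Integrable (fun g => vec (cycle E.φ C g)) E.μ) (m : ℕ) :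
    E.qR m = 2 ^ n * (entry E.ρ₀ (zeroBits n) (zeroBits n)
      ((average E.μ E.φ hI ^ m) (vec (centeredMeasurement E.M)))).re := by
  have h1 : average E.μ E.φ hI (vec (depolarizing n)) = vec (depolarizing n) := by
    rw [average_apply, LinearEquiv.symm_apply_apply]
    have h2 : ∀ᵐ g ∂E.μ, vec (cycle E.φ (depolarizing n) g) = vec (depolarizing n) := by
      filter_upwards [E.ae_mem] with g hg
      rw [cycle_depolarizing (E.isChannel g hg).tracePreserving]
    rw [integral_congr_ae h2]
    simp
  have h2 : (average E.μ E.φ hI ^ m) (vec (depolarizing n)) = vec (depolarizing n) := by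
    induction m with
    | zero => rfl
    | succ m ih => rw [pow_succ, Module.End.mul_apply, h1, ih]
  have h3 : vec (measureChannel E.M) = vec (centeredMeasurement E.M) + vec (depolarizing n) := by
    rw [← map_add, centeredMeasurement, sub_add_cancel]
  have h4 : entry E.ρ₀ (zeroBits n) (zeroBits n) (vec (depolarizing n))
      = (((2 : ℝ) ^ n)⁻¹ : ℝ) := by
    rw [entry_apply, LinearEquiv.symm_apply_apply, depolarizing_apply, E.isState.trace_eq_one]
    simp
  rw [E.qR_eq hI, h3, map_add, map_add, h2, h4, Complex.add_re, Complex.ofReal_re]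
  field_simp
  ring

end XEB

end

/-! ### The exponential decay of the linear XEB value -/

theorem mainTheorem3 (n : ℕ) (E : XEB.LinearXEB n)
    (ν : XEB.SU n → MeasureTheory.Measure (XEB.SU n)) (γ δ : ℝ)
    (hγ : XEB.IsApproxTwirlSpectral E.μ γ)
    (hν : ∀ g ∈ E.S, XEB.IsUnitaryMixture (E.φ g) (ν g))
    (hint : MeasureTheory.Integrable
      (fun g => ∫ u, XEB.diamondNorm (XEB.omega g - XEB.omega u) ∂(ν g)) E.μ)
    (hδ : ∫ g, ∫ u, XEB.diamondNorm (XEB.omega g - XEB.omega u) ∂(ν g) ∂E.μ ≤ δ)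
    (hδγ : δ ≤ (1 - γ) / 11) :
    ∃ A B p : ℝ, p ∈ Set.Icc (1 - 2 * δ) 1 ∧
      ∀ m : ℕ, |E.qR m - (A + B * p ^ m)|
        ≤ 16 * (2 : ℝ) ^ ((5 / 2 : ℝ) * (n : ℝ)) * (γ + 6 * δ) ^ m := by
  have hγ0 : 0 ≤ γ := (XEB.spectralNorm_nonneg _).trans hγ
  have hδ0 : 0 ≤ δ := le_trans (MeasureTheory.integral_nonneg fun g =>
    MeasureTheory.integral_nonneg fun u => XEB.diamondNorm_nonneg _) hδ
  have hν' : ∀ᵐ g ∂E.μ, XEB.IsUnitaryMixture (E.φ g) (ν g) := by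
    filter_upwards [E.ae_mem] with g hg using hν g hg
  have hI := XEB.integrable_vec_cycle E.aemeasurable hν'
  let z := XEB.vec (XEB.centeredMeasurement E.M)
  have hzU : z ∈ XEB.tracelessHermitian n := E.isPOVM.centeredMeasurement_mem
  have hz : ‖z‖ ≤ 2 * (2 : ℝ) ^ ((3 / 2 : ℝ) * (n : ℝ)) := by
    refine (abs_le_of_sq_le_sq' ?_ (by positivity)).2
    refine E.isPOVM.norm_sq_centeredMeasurement_le.trans (le_of_eq ?_)
    rw [mul_pow, ← Real.rpow_natCast (2 ^ ((3 / 2 : ℝ) * (n : ℝ))), ← Real.rpow_mul (by norm_num),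
      ← pow_mul, ← Real.rpow_natCast 2 (n * 3)]
    congr 1
    · norm_num
    · push_cast
      ring_nf
  have hpow : (2 : ℝ) ^ ((5 / 2 : ℝ) * (n : ℝ)) = 2 ^ n * (2 : ℝ) ^ ((3 / 2 : ℝ) * (n : ℝ)) := by
    rw [← Real.rpow_natCast 2 n, ← Real.rpow_add (by norm_num)]
    ring_nf
  have hκ : ∀ m : ℕ, 0 ≤ (γ + 6 * δ) ^ m := fun m => by positivity
  obtain ⟨p, hp, y, hy⟩ : ∃ p ∈ Set.Icc (1 - 2 * δ) 1, ∃ y : XEB.HS n, ∀ m : ℕ,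
      ‖(XEB.average E.μ E.φ hI ^ m) z - p ^ m • y‖ ≤ 3 * (γ + 6 * δ) ^ m * ‖z‖ := by
    -- For `n = 0` the vector `centering n` vanishes and cannot serve as an eigenvector, but then
    -- traceless values are zero and so is `z`.
    rcases subsingleton_or_nontrivial (XEB.Bits n) with hs | hs
    · have hz0 : z = 0 := by
        ext q
        have h := (XEB.vec_mem_tracelessHermitian.mp hzU).1 (Matrix.single q.2.1 q.2.2 1)
        rw [Matrix.trace, Fintype.sum_subsingleton _ q.1.1, Matrix.diag_apply] at h
        rw [XEB.vec_apply, ← Subsingleton.elim q.1.1 q.1.2, h]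
        rfl
      exact ⟨1, ⟨by linarith, le_rfl⟩, 0, fun m => by simp [hz0]⟩
    · obtain ⟨p, hp, h⟩ := XEB.exists_average_pow_approx hγ hν' hI hint hδ hγ0 hδ0 (by linarith)
      exact ⟨p, hp, h z hzU⟩
  let ℓ := XEB.entry E.ρ₀ (XEB.zeroBits n) (XEB.zeroBits n)
  -- The centering has already removed the constant term, so `A = 0`.
  refine ⟨0, 2 ^ n * (ℓ y).re, p, hp, fun m => ?_⟩
  have h1 : E.qR m - (0 + 2 ^ n * (ℓ y).re * p ^ m)
      = 2 ^ n * (ℓ ((XEB.average E.μ E.φ hI ^ m) z - p ^ m • y)).re := by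
    rw [E.qR_eq_centered hI, map_sub, LinearMap.map_smul_of_tower, Complex.sub_re,
      Complex.real_smul, Complex.re_ofReal_mul]
    ring
  rw [h1, abs_mul, abs_of_pos (by positivity : (0 : ℝ) < 2 ^ n), hpow]
  -- The factors 3 from the perturbation bound and 2 from `hz` give 6, below the stated 16.
  have h2 : |(ℓ ((XEB.average E.μ E.φ hI ^ m) z - p ^ m • y)).re|
      ≤ 3 * (γ + 6 * δ) ^ m * (2 * (2 : ℝ) ^ ((3 / 2 : ℝ) * (n : ℝ))) :=
    (Complex.abs_re_le_norm _).trans ((E.isState.norm_entry_le _ _ _).trans ((hy m).trans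
      (mul_le_mul_of_nonneg_left hz (mul_nonneg (by norm_num) (hκ m)))))
  have h3 : 0 ≤ (2 : ℝ) ^ n * ((γ + 6 * δ) ^ m * (2 : ℝ) ^ ((3 / 2 : ℝ) * (n : ℝ))) :=
    mul_nonneg (by positivity) (mul_nonneg (hκ m) (by positivity))
  have h4 := mul_le_mul_of_nonneg_left h2 (by positivity : (0 : ℝ) ≤ 2 ^ n)
  linarith
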